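/- Let $S$ be a countable set with the discrete topology and, for each $i\in S$, let $U_i$ be a nonempty compact metric space with its Borel $\sigma$-algebra. Let $\lambda_{ij}:U_i\to\mathbb R$ ($i,j\in S$) satisfy: for $j\ne i$, $\lambda_{ij}\ge 0$ is continuous; $\lambda_{ii}=-\sum_{j\neq i}\lambda_{ij}$ with convergence uniform on $U_i$; and $\sup_{i}\sup_{u\in U_i}\{-\lambda_{ii}(u)\}<\infty$. Let $c:\{(i,u):i\in S,\,u\in U_i\}\to[0,\infty)$ be bounded with $c(i,\cdot)$ continuous for each $i$, and let $\alpha>0$. A Markov control is a map $\mathbf u$ on $[0,\infty)\times S$ with $\mathbf u(t,i)\in U_i$ and $\mathbf u(\cdot,i)$ measurable for each $i$; it stands for the control process $U_t=\mathbf u(t,X_{t-})$. Let $\mathcal U$ be the set of Markov controls. For $\mathbf u\in\mathcal U$ and $i\in S$ let $\mathbb P_i^{\mathbf u}$ be the probability measure on the space of right-continuous paths $[0,\infty)\to S$ with left limits, with canonical process $X$, that solves the martingale problem: $X_0=i$ almost surely and, for every bounded $f:S\to\mathbb R$, the process $f(X_t)-\int_0^t\sum_j\lambda_{X_s j}(\mathbf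 u(s,X_s))f(j)\,ds$ is a martingale for the filtration $\mathcal F_t=\sigma(X_r;r\le t)$. For $\theta\in(0,1)$ put $$I_\alpha(\theta,i,\mathbf u)=\frac1\theta\log\mathbb E_i^{\mathbf u}\Bigl[\exp\Bigl(\theta\int_0^\infty e^{-\alpha t}c(X_t,U_t)\,dt\Bigr)\Bigr],$$ $$V_\alpha(\theta,i)=\inf_{\mathbf u\in\mathcal U}I_\alpha(\theta,i,\mathbf u),\qquad W_\alpha(\theta,i)=\inf_{\mathbf u\in\mathcal U}\exp[\theta I_\alpha(\theta,i,\mathbf u)].$$ Suppose $w:(0,1)\times S\to\mathbb R$ is bounded, continuously differentiable in $\theta$ for each $i$, satisfies $$\alpha\theta\frac{dw}{d\theta}(\theta,i)=\inf_{u\in U_i}\Bigl[\theta c(i,u)w(\theta,i)+\sum_j\lambda_{ij}(u)w(\theta,j)\Bigr]\quad\text{on }(0,1)\times S,$$ and $w(\theta,i)\to1$ as $\theta\to0$ uniformly in $i$. Then: 1. $w(\theta,i)=W_\alpha(\theta,i)$ for all $(\theta,i)\in(0,1)\times S$. 2. There exists a map $\mathbf u^*$ on $(0,1)\times S$, with $\mathbf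 u^*(\theta,i)\in U_i$ and $\mathbf u^*(\cdot,i)$ measurable for each $i$, such that for every $(\theta,i)\in(0,1)\times S$ the infimum in the equation is attained at $u=\mathbf u^*(\theta,i)$. 3. For every such $\mathbf u^*$ and every $\theta\in(0,1)$, the Markov control $U^*_t=\mathbf u^*(\theta e^{-\alpha t},X_{t-})$ is optimal: for every $i\in S$, $\exp[\theta I_\alpha(\theta,i,U^*)]=W_\alpha(\theta,i)$ and $I_\alpha(\theta,i,U^*)=V_\alpha(\theta,i)$. 4. $\theta^{-1}\log w(\theta,i)=V_\alpha(\theta,i)$ for all $(\theta,i)\in(0,1)\times S$. -/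

import Mathlib

open MeasureTheory ProbabilityTheory Filter Topology Set
open scoped NNReal

/-- The space `D([0,∞), S)` of right-continuous paths with left limits. -/
def CadlagPath (S : Type*) [TopologicalSpace S] : Type _ :=
  {ω : ℝ≥0 → S // (∀ t, ContinuousWithinAt ω (Ici t) t) ∧
    ∀ t, 0 < t → ∃ l, Tendsto ω (𝓝[<] t) (𝓝 l)}

namespace CadlagPath

variable {S : Type*} [TopologicalSpace S]

/-- The canonical process `X_t(ω) = ω(t)`. -/
def X (t : ℝ≥0) (ω : CadlagPath S) : S := ω.1 t

/-- The `σ`-algebra on path space generated by the canonical process; for a countable discrete `S`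
(as for every separable metric `S`) it is the Borel `σ`-algebra of the Skorokhod topology. -/
instance [MeasurableSpace S] : MeasurableSpace (CadlagPath S) :=
  ⨆ t : ℝ≥0, MeasurableSpace.comap (X t) inferInstance

/-- The canonical filtration `𝓕_t = σ(X_r; r ≤ t)`. -/
def filtration (S : Type*) [TopologicalSpace S] [MeasurableSpace S] :
    Filtration ℝ≥0 (inferInstance : MeasurableSpace (CadlagPath S)) where
  seq t := ⨆ r : ℝ≥0, ⨆ _ : r ≤ t, MeasurableSpace.comap (X r) inferInstance
  mono' _ _ hst := biSup_mono fun _ hr => le_trans hr hst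
  le' _ := iSup₂_le fun r _ =>
    le_iSup (fun r : ℝ≥0 => MeasurableSpace.comap (X (S := S) r) inferInstance) r

end CadlagPath

/-- The standing assumptions on the transition rates `lam i j u = λ_{ij}(u)`, `u ∈ U i`:
the off-diagonal rates are nonnegative and continuous, `λ_{ii} = -∑_{j ≠ i} λ_{ij}` with
convergence uniform on `U i`, and the total jump rates `-λ_{ii}` are bounded uniformly in `i`
and `u`. -/
structure IsRateFamily {S : Type*} {U : S → Type*} [∀ i, TopologicalSpace (U i)]
    (lam : (i : S) → S → U i → ℝ) : Prop where
  nonneg : ∀ i j, j ≠ i → ∀ u, 0 ≤ lam i j u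
  continuous : ∀ i j, j ≠ i → Continuous (lam i j)
  diag : ∀ i, TendstoUniformly
    (fun (F : Finset {j : S // j ≠ i}) (u : U i) => ∑ j ∈ F, lam i j u)
    (fun u => -lam i i u) atTop
  bounded : ∃ M : ℝ, ∀ i u, -lam i i u ≤ M

/-- The standing assumptions on the running cost: `c : {(i,u) : u ∈ U i} → [0,∞)` is bounded, and
`c(i,·)` is continuous for each `i`. -/
structure IsRunningCost {S : Type*} {U : S → Type*} [∀ i, TopologicalSpace (U i)]
    (c : (i : S) → U i → ℝ) : Prop where
  nonneg : ∀ i u, 0 ≤ c i u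
  continuous : ∀ i, Continuous (c i)
  bounded : ∃ C : ℝ, ∀ i u, c i u ≤ C

/-- A Markov control: `u(t,i) ∈ U i`, measurable in `t ∈ [0,∞)` for each `i`. -/
structure MarkovControl {S : Type*} (U : S → Type*) [∀ i, MeasurableSpace (U i)] where
  toFun : ℝ≥0 → (i : S) → U i
  measurable : ∀ i, Measurable fun t => toFun t i

section Control

variable {S : Type*} {U : S → Type*} [∀ i, MeasurableSpace (U i)]

/-- The controlled generator `Λ_t^u f(i) = ∑_j λ_{ij}(u(t,i)) f(j)`. -/
noncomputable def controlledGenerator (lam : (i : S) → S → U i → ℝ) (u : MarkovControl U)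
    (t : ℝ≥0) (f : S → ℝ) (i : S) : ℝ :=
  ∑' j, lam i j (u.toFun t i) * f j

variable [TopologicalSpace S] [MeasurableSpace S]

/-- `P` solves the martingale problem for `Λ^u` with initial law `μ` at time `0`: it is a
probability measure on path space, `X_0` has law `μ`, and for every bounded `f : S → ℝ` the process
`f(X_t) - ∫_0^t Λ_s^u f(X_s) ds` is a `P`-martingale for the canonical filtration. -/
structure SolvesMartingaleProblem (lam : (i : S) → S → U i → ℝ) (u : MarkovControl U)
    (μ : Measure S) (P : Measure (CadlagPath S)) : Prop where
  isProbabilityMeasure : IsProbabilityMeasure P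
  initial : P.map (CadlagPath.X 0) = μ
  martingale : ∀ f : S → ℝ, (∃ C : ℝ, ∀ i, |f i| ≤ C) →
    Martingale
      (fun (t : ℝ≥0) (ω : CadlagPath S) => f (ω.X t) -
        ∫ s in (0 : ℝ)..t, controlledGenerator lam u s.toNNReal f (ω.X s.toNNReal))
      (CadlagPath.filtration S) P

open Classical in
/-- The law `P_i^u` of the controlled chain started from `i`: the solution of the martingale problem
for `Λ^u` with initial law `δ_i` (and `0` if there were none). For a countable discrete state space
and rates satisfying `IsRateFamily` this martingale problem is well posed. -/
noncomputable def controlledLaw (lam : (i : S) → S → U i → ℝ) (u : MarkovControl U) (i : S) :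
    Measure (CadlagPath S) :=
  if h : ∃ P, SolvesMartingaleProblem lam u (Measure.dirac i) P then h.choose else 0

/-- The discounted cost `∫_0^∞ e^{-αt} c(X_t, U_t) dt` along a path, where `U_t = u(t, X_{t-})`.
As `X_{t-} = X_t` for all but countably many `t`, the control is evaluated at `X_t`. -/
noncomputable def discountedCost (c : (i : S) → U i → ℝ) (α : ℝ) (u : MarkovControl U)
    (ω : CadlagPath S) : ℝ :=
  ∫ t in Ioi (0 : ℝ), Real.exp (-α * t) *
    c (ω.X t.toNNReal) (u.toFun t.toNNReal (ω.X t.toNNReal))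

/-- The risk-sensitive discounted cost
`I_α(θ,i,u) = θ⁻¹ log E_i^u exp(θ ∫_0^∞ e^{-αt} c(X_t,U_t) dt)`. -/
noncomputable def riskSensitiveCost (lam : (i : S) → S → U i → ℝ) (c : (i : S) → U i → ℝ)
    (α θ : ℝ) (i : S) (u : MarkovControl U) : ℝ :=
  1 / θ * Real.log (∫ ω, Real.exp (θ * discountedCost c α u ω) ∂(controlledLaw lam u i))

/-- The `α`-discounted value function `V_α(θ,i) = inf_u I_α(θ,i,u)`. -/
noncomputable def discountedValue (lam : (i : S) → S → U i → ℝ) (c : (i : S) → U i → ℝ)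
    (α θ : ℝ) (i : S) : ℝ :=
  ⨅ u : MarkovControl U, riskSensitiveCost lam c α θ i u

/-- The exponential discounted value function `W_α(θ,i) = inf_u exp(θ I_α(θ,i,u))`. -/
noncomputable def expDiscountedValue (lam : (i : S) → S → U i → ℝ) (c : (i : S) → U i → ℝ)
    (α θ : ℝ) (i : S) : ℝ :=
  ⨅ u : MarkovControl U, Real.exp (θ * riskSensitiveCost lam c α θ i u)

end Control

/-- The expression `θ c(i,u) φ(i) + ∑_j λ_{ij}(u) φ(j)` minimised in the HJB equation. -/
noncomputable def hjbExpr {S : Type*} {U : S → Type*} (lam : (i : S) → S → U i → ℝ)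
    (c : (i : S) → U i → ℝ) (θ : ℝ) (φ : S → ℝ) (i : S) (u : U i) : ℝ :=
  θ * c i u * φ i + ∑' j, lam i j u * φ j

/-- `ustar` is a minimising selector for `w`: measurable in `θ` for each `i`, and for every
`(θ,i) ∈ (0,1) × S` the infimum in the HJB equation is attained at `ustar(θ,i)`. The values of
`ustar` at `θ ∉ (0,1)` play no role. -/
structure IsMinimisingSelector {S : Type*} {U : S → Type*} [∀ i, MeasurableSpace (U i)]
    (lam : (i : S) → S → U i → ℝ) (c : (i : S) → U i → ℝ) (w : ℝ → S → ℝ)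
    (ustar : ℝ → (i : S) → U i) : Prop where
  measurable : ∀ i, Measurable fun θ => ustar θ i
  attains : ∀ θ ∈ Ioo (0 : ℝ) 1, ∀ i,
    ⨅ u : U i, hjbExpr lam c θ (w θ) i u = hjbExpr lam c θ (w θ) i (ustar θ i)

/-- The Markov control `U_t = ustar(θ e^{-αt}, X_{t-})`. -/
noncomputable def feedbackControl {S : Type*} {U : S → Type*} [∀ i, MeasurableSpace (U i)]
    (α θ : ℝ) (ustar : ℝ → (i : S) → U i) (h : ∀ i, Measurable fun x => ustar x i) :
    MarkovControl U where
  toFun t i := ustar (θ * Real.exp (-α * (t : ℝ))) i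
  measurable i := (h i).comp (by fun_prop)

/-!
The proof rests on three independent facts.

*Existence for the martingale problem.* The laws `controlledLaw` are chosen solutions of the
martingale problem, so all that is needed about them is that solutions exist; uniqueness plays no
role, because the verification argument applies to every solution. As the total jump rates are
bounded by some `M`, the controlled chain can be uniformised: exponential waiting times of rate `M`,
and at a jump time `r` a transition according to `I + Λ_r / M` (which may leave the state
unchanged). The theorem of Ionescu-Tulcea gives the law of the sequence of (jump time, state) pairs
(`chainLaw`). The increment over `[s, t]` of `f(X_t) - ∫₀ᵗ Λ_r f(X_r) dr` is the sum over the steps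
of the chain of contributions `jumpIncrement`. Each has mean zero given the past
(`integral_jumpIncrement`), and on the event that the `n + 1`-st jump happens after time `s`, the
path up to time `s` is a function of the first `n` jumps (`exists_history_event`). This yields the
martingale property (`exists_solvesMartingaleProblem`).

*Verification.* Let `θ_t = θ e^{-αt}`. For `g(t, j) = ± w(θ_t, j)` the HJB equation says that
`a g + ∂_t g + Λ g ≥ 0` with running rate `a = θ_t c`: with the sign `+` for every control, and with
the sign `-` for a control that attains the infimum. For such a subsolution,
`t ↦ E[exp(∫₀ᵗ a) g(t, X_t)]` is nondecreasing. This is proved without stochastic calculus for the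
time-dependent product: over a short interval `[s, t]`, replace `g(r, X_r)` and `a(r, X_r)` by their
values at frozen arguments and use the martingale property of `g(s, X)`. The error is `O((t - s)²)`
in mean, because the chain leaves its state within a time `t - s` with probability `O(t - s)`; so
every increment is at least `-C (t - s)²`, and summing over finer and finer partitions gives
monotonicity (`IsSubsolution.le_integral_exp_mul`). As `t → ∞`, `θ_t → 0` and `w(θ_t, ·) → 1`
uniformly, so `w(θ, i)` is compared with `E[exp(θ ∫₀^∞ e^{-αt} c)]` (`verification`): it is a lower
bound for every control, and is attained by every minimising feedback control.

*Measurable selection.* A function that is measurable in `θ` and continuous in `u ∈ U_i` has a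
measurable minimiser: a compact metric space is a continuous image of the Cantor space, where the
lexicographically least minimiser is measurable (`exists_measurable_minimiser`).
-/

set_option linter.unusedSectionVars false

/-! ### The generator -/

lemma abs_tsum_le_tsum_abs {ι : Type*} {f : ι → ℝ} (hf : Summable fun i => |f i|) :
    |∑' i, f i| ≤ ∑' i, |f i| := by
  have := norm_tsum_le_tsum_norm (f := f) (by simpa only [Real.norm_eq_abs] using hf)
  simpa only [Real.norm_eq_abs] using this

section Rates

variable {S : Type*} {U : S → Type*} [∀ i, TopologicalSpace (U i)] {lam : (i : S) → S → U i → ℝ}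

namespace IsRateFamily

lemma hasSum_offDiag (h : IsRateFamily lam) (i : S) (u : U i) :
    HasSum (fun j : {j : S // j ≠ i} => lam i j u) (-lam i i u) :=
  (h.diag i).tendsto_at u

lemma diag_nonpos (h : IsRateFamily lam) (i : S) (u : U i) : lam i i u ≤ 0 := by
  have := (h.hasSum_offDiag i u).nonneg (fun (j : {j : S // j ≠ i}) => h.nonneg i j j.2 u)
  linarith

lemma exists_bound (h : IsRateFamily lam) : ∃ M : ℝ, 0 < M ∧ ∀ i u, -lam i i u ≤ M := by
  obtain ⟨M, hM⟩ := h.bounded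
  exact ⟨max M 1, by positivity, fun i u => (hM i u).trans (le_max_left _ _)⟩

lemma continuous_all (h : IsRateFamily lam) (i j : S) : Continuous (lam i j) := by
  by_cases hj : j = i
  · subst hj
    have : Continuous fun u => -lam j j u := (h.diag j).continuous (Frequently.of_forall fun F =>
      continuous_finsetSum F fun k _ => h.continuous j k k.2)
    exact this.neg.congr fun u => neg_neg _
  · exact h.continuous i j hj

lemma hasSum_zero (h : IsRateFamily lam) (i : S) (u : U i) :
    HasSum (fun j => lam i j u) 0 := by
  classical
  have h1 := (hasSum_subtype_iff_indicator (f := fun j => lam i j u)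
    (s := {j | j ≠ i})).1 (h.hasSum_offDiag i u)
  have h3 := h1.add (hasSum_ite_eq i (lam i i u))
  rw [neg_add_cancel] at h3
  refine h3.congr_fun fun j => ?_
  by_cases hj : j = i <;> simp [indicator, hj]

lemma hasSum_abs (h : IsRateFamily lam) (i : S) (u : U i) :
    HasSum (fun j => |lam i j u|) (-2 * lam i i u) := by
  classical
  have h3 := (h.hasSum_zero i u).add (hasSum_ite_eq i (-2 * lam i i u))
  rw [zero_add] at h3
  refine h3.congr_fun fun j => ?_
  by_cases hj : j = i
  · subst hj
    simp only [abs_of_nonpos (h.diag_nonpos j u), if_true]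
    ring
  · simp [hj, abs_of_nonneg (h.nonneg i j hj u)]

lemma summable_abs_mul (h : IsRateFamily lam) {f : S → ℝ} {C : ℝ} (hf : ∀ j, |f j| ≤ C) (i : S)
    (u : U i) : Summable fun j => |lam i j u * f j| := by
  refine Summable.of_nonneg_of_le (fun _ => abs_nonneg _) (fun j => ?_)
    ((h.hasSum_abs i u).summable.mul_right C)
  rw [abs_mul]
  exact mul_le_mul_of_nonneg_left (hf j) (abs_nonneg _)

lemma summable_mul (h : IsRateFamily lam) {f : S → ℝ} {C : ℝ} (hf : ∀ j, |f j| ≤ C) (i : S)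
    (u : U i) : Summable fun j => lam i j u * f j :=
  (h.summable_abs_mul hf i u).of_abs

lemma abs_tsum_le (h : IsRateFamily lam) {M : ℝ} (hM : ∀ i u, -lam i i u ≤ M) {f : S → ℝ} {C : ℝ}
    (hf : ∀ j, |f j| ≤ C) (i : S) (u : U i) : |∑' j, lam i j u * f j| ≤ 2 * M * C := by
  have hC : 0 ≤ C := (abs_nonneg _).trans (hf i)
  calc |∑' j, lam i j u * f j| ≤ ∑' j, |lam i j u * f j| :=
        abs_tsum_le_tsum_abs (h.summable_abs_mul hf i u)
    _ ≤ ∑' j, |lam i j u| * C := by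
        refine (h.summable_abs_mul hf i u).tsum_le_tsum (fun j => ?_)
          ((h.hasSum_abs i u).summable.mul_right C)
        rw [abs_mul]
        exact mul_le_mul_of_nonneg_left (hf j) (abs_nonneg _)
    _ = -2 * lam i i u * C := by rw [tsum_mul_right, (h.hasSum_abs i u).tsum_eq]
    _ ≤ 2 * M * C := by
        have := hM i u
        exact mul_le_mul_of_nonneg_right (by linarith) hC

lemma abs_tsum_sub_le (h : IsRateFamily lam) {M : ℝ} (hM : ∀ i u, -lam i i u ≤ M) {f g : S → ℝ}
    {C D : ℝ} (hf : ∀ j, |f j| ≤ C) (hg : ∀ j, |g j| ≤ C) (hfg : ∀ j, |f j - g j| ≤ D) (i : S)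
    (u : U i) : |∑' j, lam i j u * f j - ∑' j, lam i j u * g j| ≤ 2 * M * D := by
  rw [← (h.summable_mul hf i u).tsum_sub (h.summable_mul hg i u)]
  simpa only [mul_sub] using h.abs_tsum_le hM hfg i u

lemma continuous_tsum (h : IsRateFamily lam) {f : S → ℝ} {C : ℝ} (hf : ∀ j, |f j| ≤ C) (i : S) :
    Continuous fun u => ∑' j, lam i j u * f j := by
  classical
  have hC : 0 ≤ C := (abs_nonneg _).trans (hf i)
  have key : TendstoUniformly (fun (F : Finset {j : S // j ≠ i}) (u : U i) =>
      ∑ j ∈ F, lam i j u * f j) (fun u => ∑' j : {j : S // j ≠ i}, lam i j u * f j) atTop := by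
    rw [Metric.tendstoUniformly_iff]
    intro ε hε
    filter_upwards [Metric.tendstoUniformly_iff.1 (h.diag i) (ε / (C + 1)) (by positivity)]
      with F hF u
    have hs := (h.summable_mul hf i u).subtype {j | j ≠ i}
    have hsa := (h.summable_abs_mul hf i u).subtype {j | j ≠ i}
    have hsl := (h.hasSum_offDiag i u).summable
    have e1 := hs.sum_add_tsum_compl (s := F)
    have e2 := hsl.sum_add_tsum_compl (s := F)
    rw [(h.hasSum_offDiag i u).tsum_eq] at e2
    have hFu := hF u
    rw [Real.dist_eq, ← e2, add_sub_cancel_left] at hFu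
    have hle : |∑' j : ((F : Set {j : S // j ≠ i})ᶜ : Set _), lam i j u * f j|
        ≤ (∑' j : ((F : Set {j : S // j ≠ i})ᶜ : Set _), lam i j u) * C := by
      rw [← tsum_mul_right]
      refine (abs_tsum_le_tsum_abs (hsa.subtype _)).trans ?_
      refine (hsa.subtype _).tsum_le_tsum (fun j => ?_) ((hsl.subtype _).mul_right C)
      change |lam i j.1.1 u * f j.1.1| ≤ lam i j.1.1 u * C
      rw [abs_mul, abs_of_nonneg (h.nonneg i j.1.1 j.1.2 u)]
      exact mul_le_mul_of_nonneg_left (hf _) (h.nonneg i j.1.1 j.1.2 u)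
    have e1' : ∑' j : {j : S // j ≠ i}, lam i j u * f j - ∑ j ∈ F, lam i j u * f j
        = ∑' j : ((F : Set {j : S // j ≠ i})ᶜ : Set _), lam i j u * f j :=
      sub_eq_of_eq_add' e1.symm
    rw [Real.dist_eq, e1']
    refine hle.trans_lt ?_
    have h5 := (le_abs_self _).trans_lt hFu
    rw [lt_div_iff₀ (by positivity)] at h5
    have h6 : 0 ≤ ∑' j : ((F : Set {j : S // j ≠ i})ᶜ : Set _), lam i j u :=
      tsum_nonneg fun j => h.nonneg i j.1.1 j.1.2 u
    nlinarith
  have hcont := key.continuous (Frequently.of_forall fun F =>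
    continuous_finsetSum F fun k _ => (h.continuous i k k.2).mul continuous_const)
  have heq : (fun u => ∑' j, lam i j u * f j) = fun u => lam i i u * f i +
      ∑' j : {j : S // j ≠ i}, lam i j u * f j := by
    funext u
    have := (h.summable_mul hf i u).sum_add_tsum_compl (s := {i})
    rw [Finset.sum_singleton] at this
    rw [← this]
    congr 1
    rw [Finset.coe_singleton]
    rfl
  rw [heq]
  exact ((h.continuous_all i i).mul continuous_const).add hcont

end IsRateFamily

lemma measurable_tsum_of_summable {ι X : Type*} [Countable ι] [MeasurableSpace X] {f : ι → X → ℝ}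
    (hf : ∀ i, Measurable (f i)) (hs : ∀ x, Summable fun i => f i x) :
    Measurable fun x => ∑' i, f i x := by
  refine measurable_of_tendsto_metrizable' (f := fun F x => ∑ i ∈ F, f i x)
    (atTop : Filter (Finset ι)) (fun F => F.measurable_fun_sum fun i _ => hf i) ?_
  rw [tendsto_pi_nhds]
  exact fun x => (hs x).hasSum

end Rates

/-! ### Measurability of the canonical process -/

section Paths

variable {S : Type*} [Countable S] [TopologicalSpace S] [DiscreteTopology S]
    [MeasurableSpace S] [DiscreteMeasurableSpace S]

/-- A right-continuous process on a countable discrete space is jointly measurable: it is the limit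
of its discretisations at the times `(⌊n t⌋ + 1) / n ↓ t`. -/
lemma measurable_uncurry_of_rightContinuous {Ω : Type*} [MeasurableSpace Ω] {Y : ℝ≥0 → Ω → S}
    (hY : ∀ t, Measurable (Y t))
    (hcont : ∀ ω t, ContinuousWithinAt (fun r => Y r ω) (Ici t) t) :
    Measurable fun p : ℝ≥0 × Ω => Y p.1 p.2 := by
  let q : ℕ → ℝ≥0 → ℝ≥0 := fun n t => (⌊t * (n + 1)⌋₊ + 1) / (n + 1)
  have hq : ∀ t, Tendsto (fun n => q n t) atTop (𝓝[≥] t) := by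
    intro t
    refine tendsto_nhdsWithin_iff.2 ⟨?_, Eventually.of_forall fun n => ?_⟩
    · have h1 : ∀ n : ℕ, t ≤ q n t := fun n => by
        rw [le_div_iff₀ (by positivity)]
        exact (Nat.lt_floor_add_one _).le
      have h2 : ∀ n : ℕ, q n t ≤ t + 1 / ((n : ℝ≥0) + 1) := fun n => by
        rw [div_le_iff₀ (by positivity), add_mul, one_div, inv_mul_cancel₀ (by positivity)]
        gcongr
        exact Nat.floor_le (by positivity)
      have h3 : Tendsto (fun n : ℕ => t + 1 / ((n : ℝ≥0) + 1)) atTop (𝓝 (t + 0)) :=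
        tendsto_const_nhds.add tendsto_one_div_add_atTop_nhds_zero_nat
      rw [add_zero] at h3
      exact tendsto_of_tendsto_of_tendsto_of_le_of_le tendsto_const_nhds h3 h1 h2
    · rw [mem_Ici, le_div_iff₀ (by positivity)]
      exact (Nat.lt_floor_add_one _).le
  have : BorelSpace S := ⟨by
    rw [borel_eq_top_of_discrete]
    exact eq_top_iff.2 fun _ _ => .of_discrete⟩
  refine measurable_of_tendsto_metrizable' (f := fun n (p : ℝ≥0 × Ω) => Y (q n p.1) p.2) atTop
    (fun n => ?_) ?_
  · have h1 : Measurable fun p : ℕ × Ω => Y ((p.1 + 1) / (n + 1)) p.2 :=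
      measurable_from_prod_countable_right fun k => hY ((k + 1) / (n + 1))
    have h2 : Measurable fun p : ℝ≥0 × Ω => (⌊p.1 * (n + 1)⌋₊, p.2) :=
      (Nat.measurable_floor.comp (measurable_fst.mul_const _)).prodMk measurable_snd
    have h3 := h1.comp h2
    simp only [Function.comp_def] at h3
    exact h3
  · rw [tendsto_pi_nhds]
    exact fun p => Tendsto.comp (hcont p.2 p.1) (hq p.1)

lemma stronglyMeasurable_pathIntegral {Ω : Type*} [MeasurableSpace Ω] {Y : ℝ≥0 → Ω → S}
    (hY : ∀ t, Measurable (Y t))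
    (hcont : ∀ ω t, ContinuousWithinAt (fun r => Y r ω) (Ici t) t)
    {b : ℝ → S → ℝ} (hb : ∀ j, Measurable fun r => b r j) (ν : Measure ℝ) [SFinite ν] :
    StronglyMeasurable fun ω => ∫ r, b r (Y r.toNNReal ω) ∂ν := by
  have hb' : Measurable fun p : ℝ × S => b p.1 p.2 :=
    measurable_from_prod_countable_left fun j => hb j
  have h1 : Measurable fun p : Ω × ℝ => b p.2 (Y p.2.toNNReal p.1) :=
    hb'.comp (measurable_snd.prodMk ((measurable_uncurry_of_rightContinuous hY hcont).comp
      (measurable_real_toNNReal.comp measurable_snd |>.prodMk measurable_fst)))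
  exact h1.stronglyMeasurable.integral_prod_right'

namespace CadlagPath

lemma measurable_X (t : ℝ≥0) : Measurable (X (S := S) t) :=
  measurable_iff_comap_le.2
    (le_iSup (fun r : ℝ≥0 => MeasurableSpace.comap (X (S := S) r) inferInstance) t)

lemma measurable_filtration_X {r t : ℝ≥0} (h : r ≤ t) : Measurable[filtration S t] (X (S := S) r) :=
  measurable_iff_comap_le.2 (le_iSup₂_of_le (f := fun (r : ℝ≥0) (_ : r ≤ t) =>
    MeasurableSpace.comap (X (S := S) r) inferInstance) r h le_rfl)

lemma continuousWithinAt_X (ω : CadlagPath S) (t : ℝ≥0) :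
    ContinuousWithinAt (fun r => ω.X r) (Ici t) t := ω.2.1 t

lemma measurable_uncurry_X : Measurable fun p : ℝ × CadlagPath S => p.2.X p.1.toNNReal :=
  (measurable_uncurry_of_rightContinuous measurable_X continuousWithinAt_X).comp
    ((measurable_real_toNNReal.comp measurable_fst).prodMk measurable_snd)

lemma stronglyMeasurable_filtration_integral {b : ℝ → S → ℝ} (hb : ∀ j, Measurable fun r => b r j)
    (t : ℝ≥0) :
    StronglyMeasurable[filtration S t] fun ω : CadlagPath S =>
      ∫ r in (0 : ℝ)..t, b r (ω.X r.toNNReal) := by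
  have hcont : ∀ (ω : CadlagPath S) (v : ℝ≥0),
      ContinuousWithinAt (fun r => ω.X (min r t)) (Ici v) v := fun ω v => by
    have h1 : ContinuousWithinAt (fun r : ℝ≥0 => min r t) (Ici v) v := by fun_prop
    exact ContinuousWithinAt.comp (continuousWithinAt_X ω (min v t)) h1 fun r hr =>
      min_le_min_right t hr
  have key : StronglyMeasurable[filtration S t] fun ω : CadlagPath S =>
      ∫ r in Ioc (0 : ℝ) t, b r (ω.X (min r.toNNReal t)) :=
    @stronglyMeasurable_pathIntegral S _ _ _ _ _ (CadlagPath S) (filtration S t)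
      (fun r ω => ω.X (min r t)) (fun r => measurable_filtration_X (min_le_right r t)) hcont b hb
      (volume.restrict (Ioc 0 t)) _
  convert! key using 2 with ω
  rw [intervalIntegral.integral_of_le t.coe_nonneg]
  refine setIntegral_congr_fun measurableSet_Ioc fun r hr => ?_
  rw [min_eq_left (Real.toNNReal_le_iff_le_coe.2 hr.2)]

end CadlagPath

end Paths

/-! ### Increments under the martingale problem -/

section Verification

variable {S : Type*} [Countable S] [TopologicalSpace S] [DiscreteTopology S]
    [MeasurableSpace S] [DiscreteMeasurableSpace S]
    {U : S → Type*} [∀ i, TopologicalSpace (U i)] [∀ i, MeasurableSpace (U i)]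
    [∀ i, BorelSpace (U i)] {lam : (i : S) → S → U i → ℝ} {u : MarkovControl U}

lemma measurable_controlledGenerator (hlam : IsRateFamily lam) (u : MarkovControl U) {f : S → ℝ}
    {C : ℝ} (hf : ∀ j, |f j| ≤ C) (j : S) :
    Measurable fun r : ℝ => controlledGenerator lam u r.toNNReal f j :=
  (hlam.continuous_tsum hf j).measurable.comp ((u.measurable j).comp measurable_real_toNNReal)

/-- A bounded measurable function of time and state is integrable along paths over bounded
intervals. -/
lemma CadlagPath.intervalIntegrable {b : ℝ → S → ℝ} (hb : ∀ j, Measurable fun r => b r j) {K : ℝ}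
    {s t : ℝ} (hK : ∀ r ∈ uIoc s t, ∀ j, |b r j| ≤ K) (ω : CadlagPath S) :
    IntervalIntegrable (fun r => b r (ω.X r.toNNReal)) volume s t := by
  have hb' : Measurable fun p : ℝ × S => b p.1 p.2 :=
    measurable_from_prod_countable_left fun j => hb j
  have hm : Measurable fun r : ℝ => b r (ω.X r.toNNReal) :=
    hb'.comp (measurable_id.prodMk
      (CadlagPath.measurable_uncurry_X.comp (measurable_id.prodMk measurable_const)))
  rw [intervalIntegrable_iff]
  exact Measure.integrableOn_of_bounded (M := K) (by simp) hm.aestronglyMeasurable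
    ((ae_restrict_iff' measurableSet_uIoc).2 (ae_of_all _ fun r hr => hK r hr _))

lemma CadlagPath.stronglyMeasurable_intervalIntegral {b : ℝ → S → ℝ}
    (hb : ∀ j, Measurable fun r => b r j) (s t : ℝ) :
    StronglyMeasurable fun ω : CadlagPath S => ∫ r in s..t, b r (ω.X r.toNNReal) := by
  have key : ∀ a b' : ℝ, StronglyMeasurable fun ω : CadlagPath S =>
      ∫ r in Ioc a b', b r (ω.X r.toNNReal) := fun a b' =>
    stronglyMeasurable_pathIntegral CadlagPath.measurable_X CadlagPath.continuousWithinAt_X hb _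
  exact (key s t).sub (key t s)

namespace SolvesMartingaleProblem

variable {μ : Measure S} {P : Measure (CadlagPath S)}

/-- Increments of the martingale associated with `f` are orthogonal to the past. -/
lemma integral_mul_increment (hP : SolvesMartingaleProblem lam u μ P) (hlam : IsRateFamily lam)
    {f : S → ℝ} {C : ℝ} (hf : ∀ j, |f j| ≤ C) {s t : ℝ≥0} (hst : s ≤ t) {G : CadlagPath S → ℝ}
    (hG : StronglyMeasurable[CadlagPath.filtration S s] G) {D : ℝ} (hD : ∀ ω, |G ω| ≤ D) :
    ∫ ω, G ω * (f (ω.X t) - f (ω.X s)) ∂P =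
      ∫ ω, G ω * (∫ r in (s : ℝ)..t,
        controlledGenerator lam u r.toNNReal f (ω.X r.toNNReal)) ∂P := by
  obtain ⟨M, hM0, hM⟩ := hlam.exists_bound
  have := hP.isProbabilityMeasure
  have hmart := hP.martingale f ⟨C, hf⟩
  set Z : ℝ≥0 → CadlagPath S → ℝ := fun (t : ℝ≥0) (ω : CadlagPath S) => f (ω.X t) -
        ∫ s in (0 : ℝ)..t, controlledGenerator lam u s.toNNReal f (ω.X s.toNNReal) with hZ
  have hle := (CadlagPath.filtration S).le s
  have hGm : AEStronglyMeasurable G P := (hG.mono hle).aestronglyMeasurable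
  have hint : ∀ r, Integrable (G * Z r) P := fun r =>
    (hmart.integrable r).bdd_mul hGm (c := D) (ae_of_all _ fun ω => hD ω)
  have h1 : ∫ ω, (G * Z t) ω ∂P = ∫ ω, (G * Z s) ω ∂P := by
    rw [← integral_condExp hle]
    refine integral_congr_ae ?_
    filter_upwards [condExp_mul_of_stronglyMeasurable_left hG (hint t) (hmart.integrable t),
      hmart.condExp_ae_eq hst] with ω h2 h3
    rw [h2, Pi.mul_apply, h3, Pi.mul_apply]
  have hbd : ∀ r (_ : r ∈ univ) j, |controlledGenerator lam u (Real.toNNReal r) f j| ≤ 2 * M * C :=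
    fun r _ j => hlam.abs_tsum_le hM hf j _
  have hII : ∀ (a b : ℝ) ω, IntervalIntegrable (fun r => controlledGenerator lam u r.toNNReal f
      (CadlagPath.X r.toNNReal ω)) volume a b := fun a b ω =>
    CadlagPath.intervalIntegrable (b := fun r => controlledGenerator lam u r.toNNReal f)
      (measurable_controlledGenerator hlam u hf) (fun r _ => hbd r trivial) ω
  have h2 : ∀ ω, G ω * (f (ω.X t) - f (ω.X s)) - G ω * ∫ r in (s : ℝ)..t,
      controlledGenerator lam u r.toNNReal f (ω.X r.toNNReal) = (G * Z t) ω - (G * Z s) ω := by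
    intro ω
    rw [← intervalIntegral.integral_interval_sub_left (hII 0 t ω) (hII 0 s ω)]
    simp only [Pi.mul_apply, hZ]
    ring
  have hfm : ∀ r, Measurable fun ω : CadlagPath S => f (ω.X r) := fun r =>
    (Measurable.of_discrete (f := f)).comp (CadlagPath.measurable_X r)
  have hA : Integrable (fun ω : CadlagPath S => G ω * (f (ω.X t) - f (ω.X s))) P := by
    refine Integrable.bdd_mul (c := D) ?_ hGm (ae_of_all _ fun ω => hD ω)
    refine Integrable.of_bound ((hfm t).sub (hfm s)).aestronglyMeasurable (C + C)
      (ae_of_all _ fun ω => (abs_sub _ _).trans (add_le_add (hf _) (hf _)))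
  have hB : Integrable (fun ω : CadlagPath S => G ω * ∫ r in (s : ℝ)..t,
      controlledGenerator lam u r.toNNReal f (ω.X r.toNNReal)) P := by
    convert hA.sub ((hint t).sub (hint s)) using 2 with ω
    simp only [Pi.sub_apply, ← h2 ω]
    ring
  rw [← sub_eq_zero, ← integral_sub hA hB, integral_congr_ae (ae_of_all _ h2),
    integral_sub (hint t) (hint s), h1, sub_self]

/-- Two time points at distance `t - s` see different states with probability at most `M (t - s)`,
where `M` bounds the total jump rates. -/
lemma measureReal_ne_le (hP : SolvesMartingaleProblem lam u μ P) (hlam : IsRateFamily lam) {M : ℝ}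
    (hM : ∀ i v, -lam i i v ≤ M) {s t : ℝ≥0} (hst : s ≤ t) :
    P.real {ω | ω.X s ≠ ω.X t} ≤ M * (t - s) := by
  classical
  have := hP.isProbabilityMeasure
  have hms : ∀ (r : ℝ≥0) (j : S), MeasurableSet {ω : CadlagPath S | ω.X r = j} := fun r j =>
    CadlagPath.measurable_X r (.of_discrete (s := {j}))
  have hj : ∀ j, P.real ({ω | ω.X s = j} ∩ {ω | ω.X t ≠ j}) ≤
      M * (t - s) * P.real {ω | ω.X s = j} := by
    intro j
    have hf : ∀ k, |(if k = j then 1 else 0 : ℝ)| ≤ 1 := fun k => by split_ifs <;> simp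
    have hG : StronglyMeasurable[CadlagPath.filtration S s]
        (indicator {ω : CadlagPath S | ω.X s = j} fun _ => (1 : ℝ)) :=
      stronglyMeasurable_const.indicator
        (CadlagPath.measurable_filtration_X le_rfl (.of_discrete (s := {j})))
    have hG1 : ∀ ω, |(indicator {ω : CadlagPath S | ω.X s = j} fun _ => (1 : ℝ)) ω| ≤ 1 :=
      fun ω => by by_cases h : ω.X s = j <;> simp [indicator, h]
    have key := hP.integral_mul_increment hlam hf hst hG hG1
    have hL : ∫ ω, (indicator {ω : CadlagPath S | ω.X s = j} fun _ => (1 : ℝ)) ω *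
        ((if ω.X t = j then 1 else 0) - (if ω.X s = j then 1 else 0)) ∂P =
        - P.real ({ω | ω.X s = j} ∩ {ω | ω.X t ≠ j}) := by
      have hmeas : MeasurableSet ({ω : CadlagPath S | ω.X s = j} ∩ {ω | ω.X t ≠ j}) :=
        (hms s j).inter (hms t j).compl
      rw [← integral_indicator_one hmeas, ← integral_neg]
      refine integral_congr_ae (ae_of_all _ fun ω => ?_)
      by_cases h1 : ω.X s = j <;> by_cases h2 : ω.X t = j <;> simp [indicator, h1, h2]
    have hb := measurable_controlledGenerator hlam u hf
    have hd : 0 ≤ (t : ℝ) - s := sub_nonneg.2 hst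
    have hM0 : 0 ≤ M := by
      obtain ⟨v⟩ : Nonempty (U j) := ⟨u.toFun 0 j⟩
      linarith [hM j v, hlam.diag_nonpos j v]
    have hlow : ∀ ω : CadlagPath S, -(M * (t - s)) ≤ ∫ r in (s : ℝ)..t,
        controlledGenerator lam u r.toNNReal (fun k => if k = j then 1 else 0)
          (ω.X r.toNNReal) := by
      intro ω
      have h1 : ∫ _ in (s : ℝ)..t, -M ≤ ∫ r in (s : ℝ)..t,
          controlledGenerator lam u r.toNNReal (fun k => if k = j then 1 else 0)
            (ω.X r.toNNReal) := by
        refine intervalIntegral.integral_mono_on hst (by simp)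
          (CadlagPath.intervalIntegrable (b := fun r => controlledGenerator lam u r.toNNReal _) hb
            (fun r _ k => hlam.abs_tsum_le hM hf k _) ω) fun r _ => ?_
        simp only [controlledGenerator, mul_ite, mul_one, mul_zero, tsum_ite_eq]
        by_cases h : ω.X r.toNNReal = j
        · have := hM j (u.toFun r.toNNReal j)
          rw [h]
          linarith
        · have := hlam.nonneg _ _ (Ne.symm h) (u.toFun r.toNNReal _)
          linarith
      rw [intervalIntegral.integral_const, smul_eq_mul] at h1
      linarith
    have hR : -(M * (t - s)) * P.real {ω | ω.X s = j} ≤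
        ∫ ω, (indicator {ω : CadlagPath S | ω.X s = j} fun _ => (1 : ℝ)) ω *
        (∫ r in (s : ℝ)..t, controlledGenerator lam u r.toNNReal
          (fun k => if k = j then 1 else 0) (ω.X r.toNNReal)) ∂P := by
      rw [← integral_indicator_one (hms s j), ← integral_const_mul]
      refine integral_mono_ae ?_ ?_ (ae_of_all _ fun ω => ?_)
      · exact (((integrable_const (1 : ℝ)).indicator (hms s j)).const_mul _)
      · refine Integrable.bdd_mul (c := 1) ?_
          (hG.mono ((CadlagPath.filtration S).le s)).aestronglyMeasurable (ae_of_all _ hG1)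
        refine Integrable.of_bound (CadlagPath.stronglyMeasurable_intervalIntegral
          (b := fun r => controlledGenerator lam u r.toNNReal _) hb s t).aestronglyMeasurable
          (2 * M * 1 * |(t : ℝ) - s|) (ae_of_all _ fun ω => ?_)
        exact intervalIntegral.norm_integral_le_of_norm_le_const fun r _ =>
          hlam.abs_tsum_le hM hf _ _
      · by_cases h : ω.X s = j
        · simpa [indicator, h] using hlow ω
        · simp [indicator, h]
    rw [← key, hL] at hR
    linarith
  have hd : 0 ≤ M * ((t : ℝ) - s) := by
    obtain ⟨ω⟩ := P.nonempty_of_neZero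
    have := hM (ω.X s) (u.toFun 0 _)
    exact mul_nonneg (by linarith [hlam.diag_nonpos (ω.X s) (u.toFun 0 _)]) (sub_nonneg.2 hst)
  -- sum over the state at time `s`
  have hcover : {ω : CadlagPath S | ω.X s ≠ ω.X t} ⊆
      ⋃ j, ({ω | ω.X s = j} ∩ {ω | ω.X t ≠ j}) := fun ω hω =>
    mem_iUnion.2 ⟨ω.X s, rfl, fun h => hω h.symm⟩
  have hE : P {ω | ω.X s ≠ ω.X t} ≤ ENNReal.ofReal (M * (t - s)) := by
    calc P {ω | ω.X s ≠ ω.X t} ≤ ∑' j, P ({ω | ω.X s = j} ∩ {ω | ω.X t ≠ j}) :=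
          (measure_mono hcover).trans (measure_iUnion_le _)
      _ ≤ ∑' j, ENNReal.ofReal (M * (t - s)) * P {ω | ω.X s = j} := by
          refine ENNReal.tsum_le_tsum fun j => ?_
          rw [← ofReal_measureReal (μ := P), ← ofReal_measureReal (μ := P),
            ← ENNReal.ofReal_mul hd]
          exact ENNReal.ofReal_le_ofReal (hj j)
      _ = ENNReal.ofReal (M * (t - s)) * P univ := by
          rw [ENNReal.tsum_mul_left, ← measure_iUnion _ (fun j => hms s j)]
          · congr 2
            exact eq_univ_of_forall fun ω => mem_iUnion.2 ⟨ω.X s, rfl⟩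
          · intro j k hjk
            exact Set.disjoint_left.2 fun ω h1 h2 => hjk (h1.symm.trans h2)
      _ = ENNReal.ofReal (M * (t - s)) := by rw [measure_univ, mul_one]
  exact ENNReal.toReal_le_of_le_ofReal hd hE

end SolvesMartingaleProblem

end Verification

/-! ### Subsolutions of the backward equation -/

/-- A function whose increments over short intervals are at least minus a multiple of the squared
length does not decrease. -/
lemma le_of_increment_ge_sq {h : ℝ → ℝ} {T C δ : ℝ} (hT : 0 ≤ T) (hδ : 0 < δ)
    (H : ∀ s t, 0 ≤ s → s ≤ t → t ≤ T → t - s ≤ δ → -(C * (t - s) ^ 2) ≤ h t - h s) :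
    h 0 ≤ h T := by
  have hlim : Tendsto (fun n : ℕ => -(C * T ^ 2 * (1 / ((n : ℝ) + 1)))) atTop (𝓝 0) := by
    have := (tendsto_one_div_add_atTop_nhds_zero_nat (𝕜 := ℝ)).const_mul (C * T ^ 2)
    simpa using this.neg
  have hlim2 : Tendsto (fun n : ℕ => T * (1 / ((n : ℝ) + 1))) atTop (𝓝 0) := by
    simpa using (tendsto_one_div_add_atTop_nhds_zero_nat (𝕜 := ℝ)).const_mul T
  suffices h0 : 0 ≤ h T - h 0 by linarith
  refine le_of_tendsto hlim ?_
  filter_upwards [hlim2.eventually_lt_const hδ] with n hn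
  have hn0 : (0 : ℝ) < n + 1 := by positivity
  have hsum : h T - h 0 = ∑ k ∈ Finset.range (n + 1),
      (h (((k + 1 : ℕ) : ℝ) * (T / (n + 1))) - h ((k : ℝ) * (T / (n + 1)))) := by
    rw [Finset.sum_range_sub (fun k : ℕ => h ((k : ℝ) * (T / (n + 1))))]
    congr 2
    · push_cast; field_simp
    · simp
  rw [hsum]
  have hstep : ∀ k ∈ Finset.range (n + 1), -(C * (T / (n + 1)) ^ 2) ≤
      h (((k + 1 : ℕ) : ℝ) * (T / (n + 1))) - h ((k : ℝ) * (T / (n + 1))) := by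
    intro k hk
    have hk' : ((k + 1 : ℕ) : ℝ) ≤ n + 1 := by exact_mod_cast Finset.mem_range.1 hk
    have hq : 0 ≤ T / ((n : ℝ) + 1) := by positivity
    have e : ((k + 1 : ℕ) : ℝ) * (T / (n + 1)) - (k : ℝ) * (T / (n + 1)) = T / (n + 1) := by
      push_cast; ring
    have := H ((k : ℝ) * (T / (n + 1))) (((k + 1 : ℕ) : ℝ) * (T / (n + 1))) (by positivity)
      (by linarith) (by
        calc ((k + 1 : ℕ) : ℝ) * (T / (n + 1)) ≤ (n + 1) * (T / (n + 1)) := by gcongr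
          _ = T := by field_simp) (by rw [e, div_eq_mul_one_div]; exact hn.le)
    rwa [e] at this
  refine le_trans (le_of_eq ?_) (Finset.sum_le_sum hstep)
  rw [Finset.sum_const, Finset.card_range, nsmul_eq_mul]
  push_cast
  field_simp

section Verification

variable {S : Type*} [Countable S] [TopologicalSpace S] [DiscreteTopology S]
    [MeasurableSpace S] [DiscreteMeasurableSpace S]
    {U : S → Type*} [∀ i, TopologicalSpace (U i)] [∀ i, MeasurableSpace (U i)]
    [∀ i, BorelSpace (U i)] {lam : (i : S) → S → U i → ℝ} {u : MarkovControl U}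

/-- `g` is a bounded subsolution, with time derivative `g'`, of the linear backward equation
`a g + ∂_t g + Λ^u g = 0` with running rate `a ≥ 0`. Everything is required at nonnegative times
only. -/
structure IsSubsolution (lam : (i : S) → S → U i → ℝ) (u : MarkovControl U)
    (a g g' : ℝ → S → ℝ) (K B L : ℝ) : Prop where
  measurable_rate : ∀ j, Measurable fun r => a r j
  rate_nonneg : ∀ r, 0 ≤ r → ∀ j, 0 ≤ a r j
  rate_le : ∀ r, 0 ≤ r → ∀ j, a r j ≤ K
  bound : ∀ r, 0 ≤ r → ∀ j, |g r j| ≤ B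
  measurable_deriv : ∀ j, Measurable fun r => g' r j
  deriv_bound : ∀ r, 0 ≤ r → ∀ j, |g' r j| ≤ L
  integral_deriv : ∀ s t, 0 ≤ s → s ≤ t → ∀ j, g t j - g s j = ∫ r in s..t, g' r j
  drift_nonneg : ∀ r, 0 ≤ r → ∀ j,
    0 ≤ a r j * g r j + g' r j + controlledGenerator lam u r.toNNReal (g r) j

namespace IsSubsolution

variable {a g g' : ℝ → S → ℝ} {K B L M : ℝ}

lemma abs_sub_le (h : IsSubsolution lam u a g g' K B L) {s t : ℝ} (hs : 0 ≤ s) (hst : s ≤ t)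
    (j : S) : |g t j - g s j| ≤ L * (t - s) := by
  rw [h.integral_deriv s t hs hst j, ← abs_of_nonneg (sub_nonneg.2 hst)]
  refine intervalIntegral.norm_integral_le_of_norm_le_const (E := ℝ) fun r hr => ?_
  rw [uIoc_of_le hst] at hr
  exact h.deriv_bound r (hs.trans hr.1.le) j

/-- Along every path, freezing the arguments of `a g + ∂_t g + Λ^u g` at the end points of `[s, t]`
costs at most a quadratic term plus a multiple of the time spent away from the terminal state. -/
lemma pathwise_increment (h : IsSubsolution lam u a g g' K B L) (hlam : IsRateFamily lam)
    (hM : ∀ i v, -lam i i v ≤ M) {s t : ℝ≥0} (hst : s ≤ t) (hK : K * ((t : ℝ) - s) ≤ 1)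
    (ω : CadlagPath S) [DecidableEq S] :
    -((B * K ^ 2 + K * L + 2 * M * L) * ((t : ℝ) - s) ^ 2 +
      (2 * B * K + 2 * L) * ∫ r in (s : ℝ)..t, if ω.X r.toNNReal = ω.X t then (0 : ℝ) else 1) ≤
    (Real.exp (∫ r in (s : ℝ)..t, a r (ω.X r.toNNReal)) - 1) * g t (ω.X t) +
      (g t (ω.X t) - g s (ω.X t)) +
      ∫ r in (s : ℝ)..t, controlledGenerator lam u r.toNNReal (g s) (ω.X r.toNNReal) := by
  have hst' : (s : ℝ) ≤ t := hst
  have hd : 0 ≤ (t : ℝ) - s := sub_nonneg.2 hst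
  have hs0 : (0 : ℝ) ≤ s := s.2
  have ht0 : (0 : ℝ) ≤ t := t.2
  have hK0 : 0 ≤ K := (h.rate_nonneg 0 le_rfl (ω.X t)).trans (h.rate_le 0 le_rfl _)
  have hB0 : 0 ≤ B := (abs_nonneg _).trans (h.bound 0 le_rfl (ω.X t))
  have hL0 : 0 ≤ L := (abs_nonneg _).trans (h.deriv_bound 0 le_rfl (ω.X t))
  have hM0 : 0 ≤ M := by
    have := hM (ω.X t) (u.toFun 0 _)
    linarith [hlam.diag_nonpos (ω.X t) (u.toFun 0 _)]
  have hIa : IntervalIntegrable (fun r => a r (ω.X r.toNNReal)) volume s t :=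
    CadlagPath.intervalIntegrable h.measurable_rate (K := K) (fun r hr j => by
      rw [uIoc_of_le hst'] at hr
      have hr0 := hs0.trans hr.1.le
      rw [abs_of_nonneg (h.rate_nonneg r hr0 j)]
      exact h.rate_le r hr0 j) ω
  have hIg' : IntervalIntegrable (fun r => g' r (ω.X t)) volume s t :=
    CadlagPath.intervalIntegrable (b := fun r _ => g' r (ω.X t)) (fun _ => h.measurable_deriv _)
      (K := L) (fun r hr j => by
      rw [uIoc_of_le hst'] at hr
      exact h.deriv_bound r (hs0.trans hr.1.le) _) ω
  have hIL : IntervalIntegrable (fun r => controlledGenerator lam u r.toNNReal (g s)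
      (ω.X r.toNNReal)) volume s t :=
    CadlagPath.intervalIntegrable (b := fun r => controlledGenerator lam u r.toNNReal (g s))
      (measurable_controlledGenerator hlam u (h.bound s hs0))
      (fun r _ j => hlam.abs_tsum_le hM (h.bound s hs0) j _) ω
  have hI1 : IntervalIntegrable (fun r => if ω.X r.toNNReal = ω.X t then (0 : ℝ) else 1)
      volume s t :=
    CadlagPath.intervalIntegrable (b := fun _ j => if j = ω.X t then (0 : ℝ) else 1)
      (fun _ => measurable_const) (K := 1) (fun r _ j => by split_ifs <;> simp) ω
  set A := ∫ r in (s : ℝ)..t, a r (ω.X r.toNNReal) with hA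
  have hA0 : 0 ≤ A := intervalIntegral.integral_nonneg hst' fun r hr =>
    h.rate_nonneg r (hs0.trans hr.1) _
  have hAK : A ≤ K * (t - s) := by
    have := intervalIntegral.integral_mono_on hst' hIa (g := fun _ => K) (by simp)
      fun r hr => h.rate_le r (hs0.trans hr.1) _
    rw [intervalIntegral.integral_const, smul_eq_mul] at this
    linarith
  have hexp : |Real.exp A - 1 - A| ≤ (K * (t - s)) ^ 2 := by
    refine (Real.abs_exp_sub_one_sub_id_le ?_).trans (by gcongr)
    rw [abs_of_nonneg hA0]
    exact hAK.trans hK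
  have h1 : A * g t (ω.X t) - B * (K * (t - s)) ^ 2 ≤ (Real.exp A - 1) * g t (ω.X t) := by
    have h2 : |(Real.exp A - 1 - A) * g t (ω.X t)| ≤ (K * (t - s)) ^ 2 * B := by
      rw [abs_mul]
      exact mul_le_mul hexp (h.bound t ht0 _) (abs_nonneg _) (by positivity)
    linarith [neg_abs_le ((Real.exp A - 1 - A) * g t (ω.X t))]
  have h3 : ∫ r in (s : ℝ)..t, -((K * L + 2 * M * L) * (t - s) + (2 * B * K + 2 * L) *
        if ω.X r.toNNReal = ω.X t then (0 : ℝ) else 1) ≤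
      ∫ r in (s : ℝ)..t, (a r (ω.X r.toNNReal) * g t (ω.X t) + g' r (ω.X t) +
        controlledGenerator lam u r.toNNReal (g s) (ω.X r.toNNReal)) := by
    refine intervalIntegral.integral_mono_on hst'
      ((IntervalIntegrable.add (by simp) (hI1.const_mul _)).neg)
      (((hIa.mul_const _).add hIg').add hIL) fun r hr => ?_
    have hr0 : 0 ≤ r := hs0.trans hr.1
    have hdr := h.drift_nonneg r hr0 (ω.X r.toNNReal)
    have hgen := hlam.abs_tsum_sub_le hM (h.bound s hs0) (h.bound r hr0) (D := L * (t - s))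
      (fun j => by
        rw [abs_sub_comm]
        refine (h.abs_sub_le hs0 hr.1 j).trans ?_
        gcongr
        exact hr.2) (ω.X r.toNNReal) (u.toFun r.toNNReal (ω.X r.toNNReal))
    have hgen' := (abs_le.1 hgen).1
    change _ ≤ controlledGenerator lam u r.toNNReal (g s) (ω.X r.toNNReal) -
      controlledGenerator lam u r.toNNReal (g r) (ω.X r.toNNReal) at hgen'
    have ha0 := h.rate_nonneg r hr0 (ω.X r.toNNReal)
    have haK := h.rate_le r hr0 (ω.X r.toNNReal)
    by_cases hX : ω.X r.toNNReal = ω.X t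
    -- in the terminal state only the time argument of `g` is frozen, at a cost of order `t - s`
    · rw [if_pos hX]
      have hgt : |g t (ω.X t) - g r (ω.X t)| ≤ L * (t - s) := by
        refine (h.abs_sub_le hr0 hr.2 _).trans ?_
        gcongr
        exact hr.1
      have h5 : |a r (ω.X r.toNNReal) * (g t (ω.X t) - g r (ω.X t))| ≤ K * (L * (t - s)) := by
        rw [abs_mul, abs_of_nonneg ha0]
        exact mul_le_mul haK hgt (abs_nonneg _) hK0
      have h6 := (abs_le.1 h5).1
      rw [hX] at h6 hdr hgen' ⊢
      linarith
    -- away from the terminal state the crude bounds suffice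
    · rw [if_neg hX]
      have h5 : |a r (ω.X r.toNNReal) * g t (ω.X t)| ≤ K * B := by
        rw [abs_mul, abs_of_nonneg ha0]
        exact mul_le_mul haK (h.bound t ht0 _) (abs_nonneg _) hK0
      have h6 : |a r (ω.X r.toNNReal) * g r (ω.X r.toNNReal)| ≤ K * B := by
        rw [abs_mul, abs_of_nonneg ha0]
        exact mul_le_mul haK (h.bound r hr0 _) (abs_nonneg _) hK0
      have h7 := (abs_le.1 (h.deriv_bound r hr0 (ω.X t))).1
      have h8 := (abs_le.1 (h.deriv_bound r hr0 (ω.X r.toNNReal))).2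
      have h9 : 0 ≤ K * L * (t - s) := by positivity
      linarith [(abs_le.1 h5).1, (abs_le.1 h6).2]
  rw [intervalIntegral.integral_neg, intervalIntegral.integral_add (by simp) (hI1.const_mul _),
    intervalIntegral.integral_add ((hIa.mul_const _).add hIg') hIL,
    intervalIntegral.integral_add (hIa.mul_const _) hIg', intervalIntegral.integral_mul_const,
    intervalIntegral.integral_const_mul, intervalIntegral.integral_const, smul_eq_mul,
    ← h.integral_deriv s t hs0 hst', intervalIntegral.integral_mul_const, ← hA] at h3
  linarith

/-- The mean time spent in `[s, t]` away from the state at time `t` is quadratic in `t - s`. -/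
lemma _root_.SolvesMartingaleProblem.integral_occupation_le {μ : Measure S}
    {P : Measure (CadlagPath S)} (hP : SolvesMartingaleProblem lam u μ P)
    (hlam : IsRateFamily lam) (hM : ∀ i v, -lam i i v ≤ M) {s t : ℝ≥0} (hst : s ≤ t)
    [DecidableEq S] :
    Integrable (fun ω : CadlagPath S =>
      ∫ r in (s : ℝ)..t, if ω.X r.toNNReal = ω.X t then (0 : ℝ) else 1) P ∧
    ∫ ω, (∫ r in (s : ℝ)..t, if ω.X r.toNNReal = ω.X t then (0 : ℝ) else 1) ∂P ≤
      M * ((t : ℝ) - s) ^ 2 := by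
  have := hP.isProbabilityMeasure
  have hst' : (s : ℝ) ≤ t := hst
  have hd : 0 ≤ (t : ℝ) - s := sub_nonneg.2 hst
  have hM0 : 0 ≤ M := by
    obtain ⟨ω⟩ := P.nonempty_of_neZero
    have := hM (ω.X t) (u.toFun 0 _)
    linarith [hlam.diag_nonpos (ω.X t) (u.toFun 0 _)]
  have hset : MeasurableSet {p : CadlagPath S × ℝ | p.1.X p.2.toNNReal = p.1.X t} := by
    have h1 : Measurable fun p : CadlagPath S × ℝ => (p.1.X p.2.toNNReal, p.1.X t) :=
      (CadlagPath.measurable_uncurry_X.comp measurable_swap).prodMk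
        ((CadlagPath.measurable_X t).comp measurable_fst)
    exact h1 (.of_discrete (s := {q : S × S | q.1 = q.2}))
  have hm : Measurable fun p : CadlagPath S × ℝ =>
      if p.1.X p.2.toNNReal = p.1.X t then (0 : ℝ) else 1 :=
    Measurable.ite hset measurable_const measurable_const
  have hint : Integrable (fun p : CadlagPath S × ℝ =>
      if p.1.X p.2.toNNReal = p.1.X t then (0 : ℝ) else 1)
      (P.prod (volume.restrict (Ioc (s : ℝ) t))) :=
    Integrable.of_bound hm.aestronglyMeasurable 1
      (ae_of_all _ fun p => by split_ifs <;> simp)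
  simp only [intervalIntegral.integral_of_le hst']
  refine ⟨hint.integral_prod_left, ?_⟩
  rw [integral_integral_swap hint]
  have hle : ∀ r ∈ Ioc (s : ℝ) t,
      ∫ ω, (if CadlagPath.X r.toNNReal ω = CadlagPath.X t ω then (0 : ℝ) else 1) ∂P ≤
        M * (t - s) := by
    intro r hr
    have hr0 : 0 ≤ r := s.2.trans hr.1.le
    have hms : MeasurableSet {ω : CadlagPath S | ω.X r.toNNReal ≠ ω.X t} := by
      have h1 : Measurable fun ω : CadlagPath S => (ω.X r.toNNReal, ω.X t) :=
        (CadlagPath.measurable_X _).prodMk (CadlagPath.measurable_X t)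
      exact h1 (.of_discrete (s := {q : S × S | q.1 ≠ q.2}))
    have e : ∫ ω, (if CadlagPath.X r.toNNReal ω = CadlagPath.X t ω then (0 : ℝ) else 1) ∂P =
        P.real {ω : CadlagPath S | ω.X r.toNNReal ≠ ω.X t} := by
      rw [← integral_indicator_one hms]
      refine integral_congr_ae (ae_of_all _ fun ω => ?_)
      by_cases hX : CadlagPath.X r.toNNReal ω = CadlagPath.X t ω <;> simp [indicator, hX]
    rw [e]
    refine (hP.measureReal_ne_le hlam hM (Real.toNNReal_le_iff_le_coe.2 hr.2)).trans ?_
    rw [Real.coe_toNNReal r hr0]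
    gcongr
    exact hr.1.le
  calc _ ≤ ∫ _ in Ioc (s : ℝ) t, M * ((t : ℝ) - s) :=
        setIntegral_mono_on hint.integral_prod_right (integrableOn_const (by simp))
          measurableSet_Ioc hle
    _ = _ := by
      rw [setIntegral_const, smul_eq_mul, Real.volume_real_Ioc_of_le hst']
      ring

/-- The weighted mean `E[exp(∫₀ᵗ a) g(t, X_t)]` of a subsolution is nondecreasing in `t`. -/
lemma le_integral_exp_mul {μ : Measure S} {P : Measure (CadlagPath S)}
    (h : IsSubsolution lam u a g g' K B L) (hlam : IsRateFamily lam)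
    (hP : SolvesMartingaleProblem lam u μ P) (T : ℝ≥0) :
    ∫ ω, g 0 (ω.X 0) ∂P ≤
      ∫ ω, Real.exp (∫ r in (0 : ℝ)..T, a r (ω.X r.toNNReal)) * g T (ω.X T) ∂P := by
  classical
  obtain ⟨M, hM0, hM⟩ := hlam.exists_bound
  have := hP.isProbabilityMeasure
  obtain ⟨ω₀⟩ := P.nonempty_of_neZero
  have hK0 : 0 ≤ K := (h.rate_nonneg 0 le_rfl (ω₀.X 0)).trans (h.rate_le 0 le_rfl _)
  have hB0 : 0 ≤ B := (abs_nonneg _).trans (h.bound 0 le_rfl (ω₀.X 0))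
  have hL0 : 0 ≤ L := (abs_nonneg _).trans (h.deriv_bound 0 le_rfl (ω₀.X 0))
  let Γ : ℝ≥0 → CadlagPath S → ℝ := fun t ω =>
    Real.exp (∫ r in (0 : ℝ)..t, a r (ω.X r.toNNReal))
  have hIa : ∀ (s t : ℝ≥0) ω, IntervalIntegrable (fun r => a r (CadlagPath.X r.toNNReal ω))
      volume s t := fun s t ω =>
    CadlagPath.intervalIntegrable h.measurable_rate (K := K) (fun r hr j => by
      have hr0 : 0 ≤ r := (le_min s.2 t.2).trans (mem_Ioc.1 hr).1.le
      rw [abs_of_nonneg (h.rate_nonneg r hr0 j)]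
      exact h.rate_le r hr0 j) ω
  have hΓm : ∀ t, StronglyMeasurable[CadlagPath.filtration S t] (Γ t) := fun t =>
    Real.continuous_exp.comp_stronglyMeasurable
      (CadlagPath.stronglyMeasurable_filtration_integral h.measurable_rate t)
  have hΓ0 : ∀ t ω, 0 ≤ Γ t ω := fun t ω => (Real.exp_pos _).le
  have hΓle : ∀ t ω, Γ t ω ≤ Real.exp (K * t) := fun t ω => by
    refine Real.exp_le_exp.2 ?_
    have := intervalIntegral.integral_mono_on t.2 (hIa 0 t ω) (g := fun _ => K) (by simp)
      fun r hr => h.rate_le r hr.1 _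
    simpa [mul_comm] using this
  have hgm : ∀ s t : ℝ≥0, Measurable fun ω : CadlagPath S => g s (ω.X t) := fun s t =>
    (Measurable.of_discrete (f := g s)).comp (CadlagPath.measurable_X t)
  have hΓi : ∀ s {F : CadlagPath S → ℝ}, Integrable F P → Integrable (fun ω => Γ s ω * F ω) P :=
    fun s F hF => hF.bdd_mul (c := Real.exp (K * s))
      ((hΓm s).mono ((CadlagPath.filtration S).le s)).aestronglyMeasurable
      (ae_of_all _ fun ω => by
        rw [Real.norm_eq_abs, abs_of_nonneg (hΓ0 s ω)]
        exact hΓle s ω)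
  have hgi : ∀ s t : ℝ≥0, Integrable (fun ω : CadlagPath S => g s (ω.X t)) P := fun s t =>
    Integrable.of_bound (hgm s t).aestronglyMeasurable B (ae_of_all _ fun ω => h.bound s s.2 _)
  -- `H T - H 0` is estimated by increments over intervals short enough for `K (t - s) ≤ 1`
  let H : ℝ → ℝ := fun t => ∫ ω, Γ t.toNNReal ω * g t.toNNReal (ω.X t.toNNReal) ∂P
  have hmono : H 0 ≤ H T := by
    have hδ : 0 < 1 / (K + 1) := by positivity
    refine le_of_increment_ge_sq (δ := 1 / (K + 1))
      (C := Real.exp (K * T) * ((B * K ^ 2 + K * L + 2 * M * L) + (2 * B * K + 2 * L) * M))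
      T.2 hδ fun s t hs hst htT hstδ => ?_
    lift s to ℝ≥0 using hs
    lift t to ℝ≥0 using s.2.trans hst
    simp only [H, Real.toNNReal_coe]
    have hst' : s ≤ t := hst
    have hd : 0 ≤ (t : ℝ) - s := sub_nonneg.2 hst
    have hKd : K * ((t : ℝ) - s) ≤ 1 := by
      calc K * ((t : ℝ) - s) ≤ (K + 1) * (1 / (K + 1)) := by gcongr; linarith
        _ = 1 := by field_simp
    let J : CadlagPath S → ℝ := fun ω =>
      ∫ r in (s : ℝ)..t, if ω.X r.toNNReal = ω.X t then (0 : ℝ) else 1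
    let G : CadlagPath S → ℝ := fun ω =>
      ∫ r in (s : ℝ)..t, controlledGenerator lam u r.toNNReal (g s) (ω.X r.toNNReal)
    obtain ⟨hJi, hJle⟩ : Integrable J P ∧ ∫ ω, J ω ∂P ≤ M * ((t : ℝ) - s) ^ 2 :=
      hP.integral_occupation_le hlam hM hst'
    have hJ0 : ∀ ω, 0 ≤ J ω := fun ω => intervalIntegral.integral_nonneg hst fun r _ => by
      split_ifs <;> simp
    have hGi : Integrable G P := by
      refine Integrable.of_bound (CadlagPath.stronglyMeasurable_intervalIntegral
          (b := fun r => controlledGenerator lam u r.toNNReal (g s))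
          (measurable_controlledGenerator hlam u (h.bound s s.2)) s t).aestronglyMeasurable
          (2 * M * B * |(t : ℝ) - s|) (ae_of_all _ fun ω => ?_)
      exact intervalIntegral.norm_integral_le_of_norm_le_const fun r _ =>
          hlam.abs_tsum_le hM (h.bound s s.2) _ _
    have hinc := hP.integral_mul_increment hlam (h.bound s s.2) hst' (hΓm s)
      (D := Real.exp (K * s)) fun ω => by
        rw [abs_of_nonneg (hΓ0 s ω)]
        exact hΓle s ω
    -- subtracting the increment of the martingale of `g(s, ·)`, weighted by the past `Γ s`, leaves
    -- the expression bounded in `pathwise_increment`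
    have hsub : ∀ ω, Γ t ω * g t (ω.X t) - Γ s ω * g s (ω.X s) -
        (Γ s ω * (g s (ω.X t) - g s (ω.X s)) - Γ s ω * G ω) =
        Γ s ω * ((Real.exp (∫ r in (s : ℝ)..t, a r (ω.X r.toNNReal)) - 1) * g t (ω.X t) +
          (g t (ω.X t) - g s (ω.X t)) + G ω) := fun ω => by
      have : Γ t ω = Γ s ω * Real.exp (∫ r in (s : ℝ)..t, a r (ω.X r.toNNReal)) := by
        have e := intervalIntegral.integral_add_adjacent_intervals (hIa 0 s ω) (hIa s t ω)
        rw [NNReal.coe_zero] at e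
        simp only [Γ]
        rw [← Real.exp_add, e]
      rw [this]
      ring
    have hint1 : Integrable (fun ω => Γ t ω * g t (ω.X t) - Γ s ω * g s (ω.X s)) P :=
      (hΓi t (hgi t t)).sub (hΓi s (hgi s s))
    have hint3 : Integrable (fun ω => Γ s ω * (g s (ω.X t) - g s (ω.X s))) P :=
      hΓi s ((hgi s t).sub (hgi s s))
    have hint2 : Integrable (fun ω => Γ s ω * (g s (ω.X t) - g s (ω.X s)) - Γ s ω * G ω) P :=
      hint3.sub (hΓi s hGi)
    have hH : ∫ ω, Γ t ω * g t (ω.X t) ∂P - ∫ ω, Γ s ω * g s (ω.X s) ∂P =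
        ∫ ω, Γ s ω * ((Real.exp (∫ r in (s : ℝ)..t, a r (ω.X r.toNNReal)) - 1) * g t (ω.X t) +
          (g t (ω.X t) - g s (ω.X t)) + G ω) ∂P := by
      rw [← integral_congr_ae (ae_of_all _ hsub)]
      rw [integral_sub hint1 hint2, integral_sub (hΓi t (hgi t t)) (hΓi s (hgi s s)),
        integral_sub hint3 (hΓi s hGi), hinc, sub_self, sub_zero]
    rw [hH]
    set c₁ := B * K ^ 2 + K * L + 2 * M * L
    set c₂ := 2 * B * K + 2 * L
    have hc₁ : 0 ≤ c₁ := by positivity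
    have hc₂ : 0 ≤ c₂ := by positivity
    calc -(Real.exp (K * T) * (c₁ + c₂ * M) * ((t : ℝ) - s) ^ 2)
        = -(Real.exp (K * T) * (c₁ * ((t : ℝ) - s) ^ 2 + c₂ * (M * ((t : ℝ) - s) ^ 2))) := by ring
      _ ≤ -(Real.exp (K * T) * (c₁ * ((t : ℝ) - s) ^ 2 + c₂ * ∫ ω, J ω ∂P)) := by gcongr
      _ = ∫ ω, -(Real.exp (K * T) * (c₁ * ((t : ℝ) - s) ^ 2 + c₂ * J ω)) ∂P := by
          rw [integral_neg, integral_const_mul,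
            integral_add (integrable_const _) (hJi.const_mul _), integral_const_mul]
          simp only [integral_const, probReal_univ, one_smul]
          rw [integral_const_mul]
      _ ≤ _ := by
          refine integral_mono_ae (((integrable_const _).add (hJi.const_mul _)).const_mul _).neg
            ((hint1.sub hint2).congr (ae_of_all _ hsub)) (ae_of_all _ fun ω => ?_)
          have hp := h.pathwise_increment hlam hM hst' hKd ω
          have hq : 0 ≤ c₁ * ((t : ℝ) - s) ^ 2 + c₂ * J ω := by
            have := hJ0 ω
            positivity
          have hΓT : Γ s ω ≤ Real.exp (K * T) := (hΓle s ω).trans <| by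
            gcongr
            exact hst.trans htT
          calc -(Real.exp (K * T) * (c₁ * ((t : ℝ) - s) ^ 2 + c₂ * J ω))
              ≤ -(Γ s ω * (c₁ * ((t : ℝ) - s) ^ 2 + c₂ * J ω)) := by gcongr
            _ = Γ s ω * -(c₁ * ((t : ℝ) - s) ^ 2 + c₂ * J ω) := by ring
            _ ≤ _ := mul_le_mul_of_nonneg_left hp (hΓ0 s ω)
  simpa [H, Γ] using hmono

/-- The infinite-horizon comparison: a subsolution with terminal value `ℓ` at time `∞` and
exponentially decaying running rate lies below `ℓ E[exp(∫₀^∞ a)]`. -/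
lemma le_mul_integral_exp {P : Measure (CadlagPath S)} {i : S} {α ℓ : ℝ}
    (h : IsSubsolution lam u a g g' K B L) (hlam : IsRateFamily lam)
    (hP : SolvesMartingaleProblem lam u (Measure.dirac i) P) (hα : 0 < α)
    (hdecay : ∀ r, 0 ≤ r → ∀ j, a r j ≤ K * Real.exp (-α * r))
    (hlim : TendstoUniformly g (fun _ => ℓ) atTop) :
    g 0 i ≤ ℓ * ∫ ω, Real.exp (∫ r in Ioi (0 : ℝ), a r (ω.X r.toNNReal)) ∂P := by
  have := hP.isProbabilityMeasure
  have hK0 : 0 ≤ K := (h.rate_nonneg 0 le_rfl i).trans (h.rate_le 0 le_rfl i)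
  have hB0 : 0 ≤ B := (abs_nonneg _).trans (h.bound 0 le_rfl i)
  have hinit : ∫ ω, g 0 (CadlagPath.X 0 ω) ∂P = g 0 i := by
    have := integral_map (μ := P) (CadlagPath.measurable_X 0).aemeasurable
      (f := g 0) (Measurable.of_discrete.aestronglyMeasurable)
    rw [← this, hP.initial, integral_dirac]
  have hdom : IntegrableOn (fun r => K * Real.exp (-α * r)) (Ioi 0) :=
    (exp_neg_integrableOn_Ioi 0 hα).const_mul K
  have hb' : Measurable fun p : ℝ × S => a p.1 p.2 :=
    measurable_from_prod_countable_left fun j => h.measurable_rate j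
  have hint : ∀ ω : CadlagPath S, IntegrableOn (fun r => a r (ω.X r.toNNReal)) (Ioi 0) := by
    intro ω
    have hm : Measurable fun r : ℝ => a r (ω.X r.toNNReal) :=
      hb'.comp (measurable_id.prodMk
        (CadlagPath.measurable_uncurry_X.comp (measurable_id.prodMk measurable_const)))
    refine hdom.mono' hm.aestronglyMeasurable
      ((ae_restrict_iff' measurableSet_Ioi).2 (ae_of_all _ fun r hr => ?_))
    rw [Real.norm_eq_abs, abs_of_nonneg (h.rate_nonneg r (le_of_lt hr) _)]
    exact hdecay r (le_of_lt hr) _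
  set D := ∫ r in Ioi (0 : ℝ), K * Real.exp (-α * r) with hD
  have hle : ∀ (n : ℕ) (ω : CadlagPath S),
      ∫ r in (0 : ℝ)..(n : ℝ≥0), a r (ω.X r.toNNReal) ≤ D := fun n ω => by
    rw [intervalIntegral.integral_of_le (NNReal.coe_nonneg _)]
    calc _ ≤ ∫ r in Ioi (0 : ℝ), a r (ω.X r.toNNReal) :=
          setIntegral_mono_set (hint ω)
            ((ae_restrict_iff' measurableSet_Ioi).2
              (ae_of_all _ fun r hr => h.rate_nonneg r (le_of_lt hr) _))
            Ioc_subset_Ioi_self.eventuallyLE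
      _ ≤ D := setIntegral_mono_on (hint ω) hdom measurableSet_Ioi
          fun r hr => hdecay r (le_of_lt hr) _
  have hconv : Tendsto (fun n : ℕ => ∫ ω, Real.exp (∫ r in (0 : ℝ)..(n : ℝ≥0),
      a r (CadlagPath.X r.toNNReal ω)) * g (n : ℝ≥0) (CadlagPath.X n ω) ∂P) atTop
      (𝓝 (∫ ω, Real.exp (∫ r in Ioi (0 : ℝ), a r (CadlagPath.X r.toNNReal ω)) * ℓ ∂P)) := by
    refine tendsto_integral_of_dominated_convergence (fun _ => Real.exp D * B) (fun n => ?_)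
      (integrable_const _) (fun n => ae_of_all _ fun ω => ?_) (ae_of_all _ fun ω => ?_)
    · exact ((Real.continuous_exp.comp_stronglyMeasurable
        (CadlagPath.stronglyMeasurable_intervalIntegral h.measurable_rate 0 _)).mul
        ((Measurable.of_discrete (f := g (n : ℝ≥0))).comp
          (CadlagPath.measurable_X n)).stronglyMeasurable).aestronglyMeasurable
    · rw [norm_mul, Real.norm_eq_abs, Real.norm_eq_abs, Real.abs_exp]
      exact mul_le_mul (Real.exp_le_exp.2 (hle n ω)) (h.bound _ (NNReal.coe_nonneg _) _)
        (abs_nonneg _) (Real.exp_pos _).le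
    · have hn : Tendsto (fun n : ℕ => (((n : ℝ≥0) : ℝ))) atTop atTop := by
        simpa using tendsto_natCast_atTop_atTop (R := ℝ)
      refine Tendsto.mul ((Real.continuous_exp.tendsto _).comp
        (intervalIntegral_tendsto_integral_Ioi 0 (hint ω) hn)) ?_
      rw [Metric.tendsto_atTop]
      intro ε hε
      obtain ⟨N, hN⟩ := eventually_atTop.1 (hn.eventually
        (Metric.tendstoUniformly_iff.1 hlim ε hε))
      exact ⟨N, fun n hn => by rw [dist_comm]; exact hN n hn _⟩
  have hbound : ∀ n : ℕ, g 0 i ≤ ∫ ω, Real.exp (∫ r in (0 : ℝ)..(n : ℝ≥0),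
      a r (CadlagPath.X r.toNNReal ω)) * g (n : ℝ≥0) (CadlagPath.X n ω) ∂P := fun n => by
    rw [← hinit]
    exact h.le_integral_exp_mul hlam hP n
  have := ge_of_tendsto' hconv hbound
  rwa [integral_mul_const, mul_comm] at this

end IsSubsolution

end Verification

/-! ### The uniformised jump kernel -/

lemma integrableOn_exp_wait {M : ℝ} (hM : 0 < M) (τ v : ℝ) :
    IntegrableOn (fun r => M * Real.exp (-M * (r - τ))) (Ioi v) := by
  have h := ((integrableOn_exp_mul_Ioi (neg_lt_zero.2 hM) v).const_mul (M * Real.exp (M * τ)))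
  refine IntegrableOn.congr_fun h (fun r _ => ?_) measurableSet_Ioi
  rw [mul_assoc, ← Real.exp_add]
  congr 2
  ring

lemma integral_exp_wait {M : ℝ} (hM : 0 < M) (τ v : ℝ) :
    ∫ r in Ioi v, M * Real.exp (-M * (r - τ)) = Real.exp (-M * (v - τ)) := by
  have h : ∀ r, M * Real.exp (-M * (r - τ)) =
      M * Real.exp (M * τ) * Real.exp (-M * r) := fun r => by
    rw [mul_assoc, ← Real.exp_add]
    congr 2
    ring
  simp only [h]
  rw [integral_const_mul, integral_exp_mul_Ioi (neg_lt_zero.2 hM),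
    show -M * (v - τ) = M * τ + -M * v by ring, Real.exp_add]
  field_simp

lemma lintegral_exp_wait {M : ℝ} (hM : 0 < M) (τ v : ℝ) :
    ∫⁻ r in Ioi v, ENNReal.ofReal (M * Real.exp (-M * (r - τ))) =
      ENNReal.ofReal (Real.exp (-M * (v - τ))) := by
  rw [← integral_exp_wait hM τ v, ofReal_integral_eq_lintegral_ofReal
    (integrableOn_exp_wait hM τ v) (ae_of_all _ fun r => by positivity)]

section JumpKernel

variable {S : Type*} [Countable S] [TopologicalSpace S] [DiscreteTopology S]
    [MeasurableSpace S] [DiscreteMeasurableSpace S]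
    {U : S → Type*} [∀ i, TopologicalSpace (U i)] [∀ i, MeasurableSpace (U i)]
    [∀ i, BorelSpace (U i)] {lam : (i : S) → S → U i → ℝ} {u : MarkovControl U} {M : ℝ}

open Classical in
/-- The transition probabilities `I + Λ_r^u / M` of the uniformised chain at time `r`. -/
noncomputable def jumpProb (lam : (i : S) → S → U i → ℝ) (u : MarkovControl U) (M : ℝ) (r : ℝ)
    (y z : S) : ℝ :=
  (if z = y then 1 else 0) + lam y z (u.toFun r.toNNReal y) / M

lemma jumpProb_nonneg (hlam : IsRateFamily lam) (hM0 : 0 < M) (hM : ∀ i v, -lam i i v ≤ M)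
    (r : ℝ) (y z : S) : 0 ≤ jumpProb lam u M r y z := by
  unfold jumpProb
  split_ifs with h
  · subst h
    have := hM z (u.toFun r.toNNReal z)
    rw [← neg_le_iff_add_nonneg', le_div_iff₀ hM0]
    linarith
  · rw [zero_add]
    exact div_nonneg (hlam.nonneg _ _ h _) hM0.le

lemma hasSum_jumpProb (hlam : IsRateFamily lam) (r : ℝ) (y : S) :
    HasSum (jumpProb lam u M r y) 1 := by
  classical
  have := (hasSum_ite_eq y (1 : ℝ)).add
    ((hlam.hasSum_zero y (u.toFun r.toNNReal y)).div_const M)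
  rw [zero_div, add_zero] at this
  exact this

lemma measurable_jumpProb (hlam : IsRateFamily lam) (y z : S) :
    Measurable fun r => jumpProb lam u M r y z :=
  (((hlam.continuous_all y z).measurable.comp
    ((u.measurable y).comp measurable_real_toNNReal)).div_const M).const_add _

/-- Averaging an increment `f z - f y` over a jump of the uniformised chain gives `Λ f / M`. -/
lemma tsum_jumpProb_mul_sub (hlam : IsRateFamily lam) {f : S → ℝ} {C : ℝ}
    (hf : ∀ j, |f j| ≤ C) (r : ℝ) (y : S) :
    ∑' z, jumpProb lam u M r y z * (f z - f y) =
      controlledGenerator lam u r.toNNReal f y / M := by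
  classical
  have h1 := (hlam.summable_mul hf y (u.toFun r.toNNReal y)).hasSum.div_const M
  have h2 := ((hlam.hasSum_zero y (u.toFun r.toNNReal y)).div_const M).mul_right (f y)
  have h3 := h1.sub h2
  rw [zero_div, zero_mul, sub_zero] at h3
  refine Eq.trans (tsum_congr fun z => ?_) h3.tsum_eq
  unfold jumpProb
  by_cases h : z = y
  · subst h
    ring
  · rw [if_neg h]
    ring

/-- The density, with respect to Lebesgue measure times counting measure, of the next point
`(r, z)` of the uniformised chain after `(τ, y)`: the waiting time `r - τ` is exponential with rate
`M`, and the new state is drawn from `I + Λ_r^u / M` at the time `r` of the jump. -/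
noncomputable def jumpDensity (lam : (i : S) → S → U i → ℝ) (u : MarkovControl U) (M : ℝ)
    (x x' : ℝ × S) : ℝ :=
  indicator (Ioi x.1) (fun r => M * Real.exp (-M * (r - x.1))) x'.1 *
    jumpProb lam u M x'.1 x.2 x'.2

lemma jumpDensity_nonneg (hlam : IsRateFamily lam) (hM0 : 0 < M) (hM : ∀ i v, -lam i i v ≤ M)
    (x x' : ℝ × S) : 0 ≤ jumpDensity lam u M x x' :=
  mul_nonneg (indicator_nonneg (fun _ _ => by positivity) _) (jumpProb_nonneg hlam hM0 hM _ _ _)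

lemma measurable_jumpDensity (hlam : IsRateFamily lam) :
    Measurable fun p : (ℝ × S) × (ℝ × S) => jumpDensity lam u M p.1 p.2 := by
  refine Measurable.mul ?_ ?_
  · have : (fun p : (ℝ × S) × (ℝ × S) =>
        indicator (Ioi p.1.1) (fun r => M * Real.exp (-M * (r - p.1.1))) p.2.1) =
        indicator {p | p.1.1 < p.2.1} fun p => M * Real.exp (-M * (p.2.1 - p.1.1)) := by
      funext p
      simp [indicator]
    rw [this]
    exact Measurable.indicator (by fun_prop) (measurableSet_lt (by fun_prop) (by fun_prop))
  · have h1 : Measurable fun p : ℝ × (S × S) => jumpProb lam u M p.1 p.2.1 p.2.2 :=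
      measurable_from_prod_countable_left fun yz => measurable_jumpProb hlam yz.1 yz.2
    exact h1.comp (f := fun p : (ℝ × S) × (ℝ × S) => (p.2.1, (p.1.2, p.2.2))) (by fun_prop)

/-- The transition kernel of the uniformised chain of (jump time, state) pairs. -/
noncomputable def jumpKernel (lam : (i : S) → S → U i → ℝ) (u : MarkovControl U) (M : ℝ) :
    Kernel (ℝ × S) (ℝ × S) :=
  Kernel.withDensity (Kernel.const _ (volume.prod Measure.count))
    fun x x' => ENNReal.ofReal (jumpDensity lam u M x x')

lemma jumpKernel_apply (hlam : IsRateFamily lam) (x : ℝ × S) :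
    jumpKernel lam u M x = (volume.prod Measure.count).withDensity
      fun x' => ENNReal.ofReal (jumpDensity lam u M x x') := by
  rw [jumpKernel, Kernel.withDensity_apply _ (measurable_jumpDensity hlam).ennreal_ofReal,
    Kernel.const_apply]

lemma measurable_jumpDensity_right (hlam : IsRateFamily lam) (x : ℝ × S) :
    Measurable (jumpDensity lam u M x) :=
  (measurable_jumpDensity hlam).comp measurable_prodMk_left

lemma lintegral_jumpKernel_fst (hlam : IsRateFamily lam) (hM0 : 0 < M)
    (hM : ∀ i v, -lam i i v ≤ M) (x : ℝ × S) {F : ℝ → ENNReal} (hF : Measurable F) :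
    ∫⁻ x', F x'.1 ∂(jumpKernel lam u M x) =
      ∫⁻ r in Ioi x.1, ENNReal.ofReal (M * Real.exp (-M * (r - x.1))) * F r := by
  have hF' : Measurable fun x' : ℝ × S => F x'.1 := hF.comp measurable_fst
  rw [jumpKernel_apply hlam, lintegral_withDensity_eq_lintegral_mul _
    (measurable_jumpDensity_right hlam x).ennreal_ofReal hF',
    lintegral_prod _ (((measurable_jumpDensity_right hlam x).ennreal_ofReal.mul
      hF').aemeasurable), ← lintegral_indicator measurableSet_Ioi]
  refine lintegral_congr fun r => ?_
  rw [lintegral_count]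
  have hnn : 0 ≤ indicator (Ioi x.1) (fun r => M * Real.exp (-M * (r - x.1))) r :=
    indicator_nonneg (fun _ _ => by positivity) _
  have hs : ∑' z, ENNReal.ofReal (jumpProb lam u M r x.2 z) = 1 := by
    rw [← ENNReal.ofReal_tsum_of_nonneg (jumpProb_nonneg hlam hM0 hM r x.2)
      (hasSum_jumpProb hlam r x.2).summable, (hasSum_jumpProb hlam r x.2).tsum_eq,
      ENNReal.ofReal_one]
  simp only [Pi.mul_apply, jumpDensity, ENNReal.ofReal_mul hnn]
  rw [ENNReal.tsum_mul_right, ENNReal.tsum_mul_left, hs, mul_one]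
  by_cases hr : x.1 < r <;> simp [indicator, hr]

lemma isMarkovKernel_jumpKernel (hlam : IsRateFamily lam) (hM0 : 0 < M)
    (hM : ∀ i v, -lam i i v ≤ M) : IsMarkovKernel (jumpKernel lam u M) := by
  refine ⟨fun x => ⟨?_⟩⟩
  have := lintegral_jumpKernel_fst (u := u) hlam hM0 hM x (F := fun _ => 1) measurable_const
  rw [lintegral_one] at this
  rw [this]
  simp only [mul_one]
  rw [lintegral_exp_wait hM0]
  simp

lemma ae_lt_jumpKernel (hlam : IsRateFamily lam) (hM0 : 0 < M)
    (hM : ∀ i v, -lam i i v ≤ M) (x : ℝ × S) : ∀ᵐ x' ∂(jumpKernel lam u M x), x.1 < x'.1 := by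
  have hm : Measurable fun x' : ℝ × S => indicator (Iic x.1) (fun _ => (1 : ENNReal)) x'.1 :=
    (measurable_const.indicator measurableSet_Iic).comp measurable_fst
  have := lintegral_jumpKernel_fst (u := u) hlam hM0 hM x
    (F := indicator (Iic x.1) fun _ => 1) (measurable_const.indicator measurableSet_Iic)
  rw [setLIntegral_congr_fun (g := fun _ => 0) measurableSet_Ioi (fun r hr => by
    simp [indicator, not_le.2 (mem_Ioi.1 hr)]), lintegral_zero, lintegral_eq_zero_iff hm] at this
  filter_upwards [this] with x' hx'
  by_contra h
  simp [indicator, not_lt.1 h] at hx'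

lemma lintegral_exp_neg_jumpKernel (hlam : IsRateFamily lam) (hM0 : 0 < M)
    (hM : ∀ i v, -lam i i v ≤ M) (x : ℝ × S) :
    ∫⁻ x', ENNReal.ofReal (Real.exp (-x'.1)) ∂(jumpKernel lam u M x) =
      ENNReal.ofReal (M / (M + 1)) * ENNReal.ofReal (Real.exp (-x.1)) := by
  rw [lintegral_jumpKernel_fst hlam hM0 hM x (F := fun r => ENNReal.ofReal (Real.exp (-r)))
    (by fun_prop)]
  have h1 : 0 < M + 1 := by positivity
  have e : ∀ r, ENNReal.ofReal (M * Real.exp (-M * (r - x.1))) * ENNReal.ofReal (Real.exp (-r)) =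
      ENNReal.ofReal (M / (M + 1) * Real.exp (-x.1)) *
        ENNReal.ofReal ((M + 1) * Real.exp (-(M + 1) * (r - x.1))) := fun r => by
    rw [← ENNReal.ofReal_mul (by positivity), ← ENNReal.ofReal_mul (by positivity)]
    congr 1
    have : Real.exp (-M * (r - x.1)) * Real.exp (-r) =
        Real.exp (-x.1) * Real.exp (-(M + 1) * (r - x.1)) := by
      rw [← Real.exp_add, ← Real.exp_add]
      congr 1
      ring
    rw [mul_assoc, this]
    field_simp
  simp only [e]
  rw [lintegral_const_mul _ (by fun_prop), lintegral_exp_wait h1,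
    ENNReal.ofReal_mul (by positivity)]
  simp

lemma integral_jumpKernel (hlam : IsRateFamily lam) (hM0 : 0 < M)
    (hM : ∀ i v, -lam i i v ≤ M) (x : ℝ × S) {F : ℝ × S → ℝ} (hF : Measurable F) {C : ℝ}
    (hC : ∀ x', |F x'| ≤ C) :
    ∫ x', F x' ∂(jumpKernel lam u M x) = ∫ r in Ioi x.1, M * Real.exp (-M * (r - x.1)) *
      ∑' z, jumpProb lam u M r x.2 z * F (r, z) := by
  have := isMarkovKernel_jumpKernel (u := u) hlam hM0 hM
  have hmd := (measurable_jumpDensity_right (u := u) (M := M) hlam x).ennreal_ofReal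
  have hint : Integrable F (jumpKernel lam u M x) :=
    Integrable.of_bound hF.aestronglyMeasurable C (ae_of_all _ hC)
  rw [jumpKernel_apply hlam, integrable_withDensity_iff_integrable_smul' hmd (by simp)] at hint
  rw [jumpKernel_apply hlam, integral_withDensity_eq_integral_toReal_smul hmd (by simp),
    integral_prod _ hint, ← integral_indicator measurableSet_Ioi]
  refine integral_congr_ae ?_
  filter_upwards [hint.prod_right_ae] with r hr
  rw [integral_countable hr]
  simp only [smul_eq_mul, ENNReal.toReal_ofReal (jumpDensity_nonneg hlam hM0 hM _ _),
    measureReal_def, Measure.count_singleton, ENNReal.toReal_one, one_mul]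
  simp only [jumpDensity, mul_assoc]
  rw [tsum_mul_left]
  by_cases h : x.1 < r <;> simp [indicator, h, mul_assoc]

end JumpKernel

/-! ### Compensation of a single jump -/

section JumpKernel

variable {S : Type*} [Countable S] [TopologicalSpace S] [DiscreteTopology S]
    [MeasurableSpace S] [DiscreteMeasurableSpace S]
    {U : S → Type*} [∀ i, TopologicalSpace (U i)] [∀ i, MeasurableSpace (U i)]
    [∀ i, BorelSpace (U i)] {lam : (i : S) → S → U i → ℝ} {u : MarkovControl U} {M : ℝ}

/-- The contribution of the step from `x = (τ, y)` to `x' = (r, z)` of the uniformised chain to the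
increment over `[s, t]` of the martingale of `f`: the jump `f z - f y` if it happens in `(s, t]`,
minus the integral of `Λ f (y)` over the part of the holding interval `[τ, r)` inside `[s, t)`. -/
noncomputable def jumpIncrement (lam : (i : S) → S → U i → ℝ) (u : MarkovControl U) (f : S → ℝ)
    (s t : ℝ) (x x' : ℝ × S) : ℝ :=
  indicator (Ioc s t) (fun _ => f x'.2 - f x.2) x'.1 -
    ∫ v in Ico (max s x.1) (min t x'.1), controlledGenerator lam u v.toNNReal f x.2

lemma measurable_uncurry_controlledGenerator (hlam : IsRateFamily lam) {f : S → ℝ} {C : ℝ}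
    (hf : ∀ j, |f j| ≤ C) :
    Measurable fun p : ℝ × S => controlledGenerator lam u p.1.toNNReal f p.2 :=
  measurable_from_prod_countable_left fun j => measurable_controlledGenerator hlam u hf j

lemma measurable_integral_controlledGenerator (hlam : IsRateFamily lam) {f : S → ℝ} {C : ℝ}
    (hf : ∀ j, |f j| ≤ C) (s t : ℝ) :
    Measurable fun p : (ℝ × S) × (ℝ × S) => ∫ v in Ico (max s p.1.1) (min t p.2.1),
      controlledGenerator lam u v.toNNReal f p.1.2 := by
  have h1 : Measurable fun q : ((ℝ × S) × (ℝ × S)) × ℝ =>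
      indicator {q : ((ℝ × S) × (ℝ × S)) × ℝ | max s q.1.1.1 ≤ q.2 ∧ q.2 < min t q.1.2.1}
        (fun q => controlledGenerator lam u q.2.toNNReal f q.1.1.2) q := by
    refine Measurable.indicator ?_ ?_
    · exact (measurable_uncurry_controlledGenerator (u := u) hlam hf).comp
        (f := fun q : ((ℝ × S) × (ℝ × S)) × ℝ => (q.2, q.1.1.2)) (by fun_prop)
    · have e1 : Measurable fun q : ((ℝ × S) × (ℝ × S)) × ℝ => max s q.1.1.1 := by fun_prop
      have e2 : Measurable fun q : ((ℝ × S) × (ℝ × S)) × ℝ => min t q.1.2.1 := by fun_prop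
      exact (measurableSet_le e1 measurable_snd).inter (measurableSet_lt measurable_snd e2)
  have h2 := (h1.stronglyMeasurable.integral_prod_right' (ν := volume)).measurable
  convert! h2 using 2 with p
  rw [← integral_indicator measurableSet_Ico]
  rfl

lemma measurable_jumpIncrement (hlam : IsRateFamily lam) {f : S → ℝ} {C : ℝ}
    (hf : ∀ j, |f j| ≤ C) (s t : ℝ) :
    Measurable fun p : (ℝ × S) × (ℝ × S) => jumpIncrement lam u f s t p.1 p.2 := by
  refine Measurable.sub ?_ (measurable_integral_controlledGenerator hlam hf s t)
  have h : Measurable fun p : (ℝ × S) × (ℝ × S) => f p.2.2 - f p.1.2 :=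
    ((Measurable.of_discrete (f := f)).comp (by fun_prop)).sub
      ((Measurable.of_discrete (f := f)).comp (by fun_prop))
  exact h.indicator (s := {p : (ℝ × S) × (ℝ × S) | p.2.1 ∈ Ioc s t})
    (measurableSet_Ioc.preimage (by fun_prop))

lemma abs_integral_controlledGenerator_le (hlam : IsRateFamily lam) (hM0 : 0 < M)
    (hM : ∀ i v, -lam i i v ≤ M) {f : S → ℝ} {C : ℝ} (hf : ∀ j, |f j| ≤ C) {s t : ℝ} (hst : s ≤ t)
    {a b : ℝ} (ha : s ≤ a) (hb : b ≤ t) (y : S) :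
    |∫ v in Ico a b, controlledGenerator lam u v.toNNReal f y| ≤ 2 * M * C * (t - s) := by
  have hC : 0 ≤ C := (abs_nonneg _).trans (hf y)
  have h2 := norm_setIntegral_le_of_norm_le_const (μ := volume) (s := Ico a b)
    (f := fun v => controlledGenerator lam u v.toNNReal f y) (C := 2 * M * C) (by simp)
    (fun v _ => hlam.abs_tsum_le hM hf y _)
  refine h2.trans ?_
  gcongr
  rw [measureReal_def, Real.volume_Ico]
  exact ENNReal.toReal_le_of_le_ofReal (sub_nonneg.2 hst)
    (ENNReal.ofReal_le_ofReal (by linarith))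

lemma abs_jumpIncrement_le (hlam : IsRateFamily lam) (hM0 : 0 < M) (hM : ∀ i v, -lam i i v ≤ M)
    {f : S → ℝ} {C : ℝ} (hf : ∀ j, |f j| ≤ C) {s t : ℝ} (hst : s ≤ t) (x x' : ℝ × S) :
    |jumpIncrement lam u f s t x x'| ≤ 2 * C + 2 * M * C * (t - s) := by
  have hC : 0 ≤ C := (abs_nonneg _).trans (hf x.2)
  refine (abs_sub _ _).trans (add_le_add ?_ (abs_integral_controlledGenerator_le hlam hM0 hM hf hst
    (le_max_left _ _) (min_le_left _ _) _))
  by_cases h : x'.1 ∈ Ioc s t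
  · rw [indicator_of_mem h]
    linarith [abs_sub (f x'.2) (f x.2), hf x'.2, hf x.2]
  · rw [indicator_of_notMem h, abs_zero]
    positivity

/-- The step contributions have conditional mean zero: the exponential hazard rate `M` of a jump
times the mean jump `Λ f / M` is compensated by the integral of `Λ f` up to the jump time. -/
lemma integral_jumpIncrement (hlam : IsRateFamily lam) (hM0 : 0 < M)
    (hM : ∀ i v, -lam i i v ≤ M) {f : S → ℝ} {C : ℝ} (hf : ∀ j, |f j| ≤ C) {s t : ℝ} (hst : s ≤ t)
    (x : ℝ × S) : ∫ x', jumpIncrement lam u f s t x x' ∂(jumpKernel lam u M x) = 0 := by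
  have := isMarkovKernel_jumpKernel (u := u) hlam hM0 hM
  obtain ⟨τ, y⟩ := x
  have hC : 0 ≤ C := (abs_nonneg _).trans (hf y)
  set D : ℝ → ℝ := fun v => controlledGenerator lam u v.toNNReal f y with hD
  have hDm : Measurable D := measurable_controlledGenerator hlam u hf y
  have hDb : ∀ v, |D v| ≤ 2 * M * C := fun v => hlam.abs_tsum_le hM hf y _
  let F₁ : ℝ × S → ℝ := fun x' => indicator (Ioc s t) (fun _ => f x'.2 - f y) x'.1
  let F₂ : ℝ × S → ℝ := fun x' => ∫ v in Ico (max s τ) (min t x'.1), D v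
  have hF₁m : Measurable F₁ :=
    (((Measurable.of_discrete (f := f)).comp measurable_snd).sub_const _).indicator
      (s := {x' : ℝ × S | x'.1 ∈ Ioc s t}) (measurableSet_Ioc.preimage measurable_fst)
  have hF₁b : ∀ x', |F₁ x'| ≤ 2 * C := fun x' => by
    by_cases h : x'.1 ∈ Ioc s t
    · simp only [F₁, indicator_of_mem h]
      linarith [abs_sub (f x'.2) (f y), hf x'.2, hf y]
    · simp only [F₁, indicator_of_notMem h, abs_zero]
      positivity
  have hF₂m : Measurable F₂ :=
    (measurable_integral_controlledGenerator (u := u) hlam hf s t).comp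
      (measurable_prodMk_left (x := (τ, y)))
  have hF₂b : ∀ x', |F₂ x'| ≤ 2 * M * C * (t - s) := fun x' =>
    abs_integral_controlledGenerator_le hlam hM0 hM hf hst (le_max_left _ _) (min_le_left _ _) y
  have hsplit : ∫ x', jumpIncrement lam u f s t (τ, y) x' ∂(jumpKernel lam u M (τ, y)) =
      ∫ x', F₁ x' ∂(jumpKernel lam u M (τ, y)) - ∫ x', F₂ x' ∂(jumpKernel lam u M (τ, y)) :=
    integral_sub (Integrable.of_bound hF₁m.aestronglyMeasurable _ (ae_of_all _ hF₁b))
      (Integrable.of_bound hF₂m.aestronglyMeasurable _ (ae_of_all _ hF₂b))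
  -- the mean jump: at rate `M` times the survival probability, jumps of mean size `Λ f / M`
  have hA : ∫ x', F₁ x' ∂(jumpKernel lam u M (τ, y)) =
      ∫ v in Ico (max s τ) t, Real.exp (-M * (v - τ)) * D v := by
    rw [integral_jumpKernel hlam hM0 hM _ hF₁m hF₁b, integral_Ico_eq_integral_Ioo,
      ← integral_Ioc_eq_integral_Ioo, ← Ioi_inter_Iic, max_comm, ← Ioi_inter_Ioi, inter_assoc,
      Ioi_inter_Iic, ← integral_indicator measurableSet_Ioi,
      ← integral_indicator (measurableSet_Ioi.inter measurableSet_Ioc), ← indicator_indicator]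
    refine integral_congr_ae (ae_of_all _ fun r => congrFun (congrArg (indicator (Ioi τ)) ?_) r)
    funext r
    by_cases h : r ∈ Ioc s t
    · simp only [F₁, indicator_of_mem h]
      rw [tsum_jumpProb_mul_sub hlam hf]
      field_simp
      rfl
    · simp only [F₁, indicator_of_notMem h]
      simp
  -- the compensator: by Fubini, `Λ f` at time `v` is weighted by the probability of no jump by `v`
  have hB : ∫ x', F₂ x' ∂(jumpKernel lam u M (τ, y)) =
      ∫ v in Ico (max s τ) t, Real.exp (-M * (v - τ)) * D v := by
    rw [integral_jumpKernel hlam hM0 hM _ hF₂m hF₂b]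
    have h1 : ∀ r, M * Real.exp (-M * (r - τ)) * ∑' z, jumpProb lam u M r y z * F₂ (r, z) =
        ∫ v in Ico (max s τ) t, M * Real.exp (-M * (r - τ)) * indicator (Iio r) D v := by
      intro r
      rw [integral_const_mul]
      congr 1
      change ∑' z, jumpProb lam u M r y z * F₂ (r, y) = _
      rw [tsum_mul_right, (hasSum_jumpProb hlam r y).tsum_eq, one_mul,
        setIntegral_indicator measurableSet_Iio, Ico_inter_Iio]
    simp only [h1]
    have hint : Integrable (fun p : ℝ × ℝ => M * Real.exp (-M * (p.1 - τ)) *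
        indicator (Iio p.1) D p.2)
        ((volume.restrict (Ioi τ)).prod (volume.restrict (Ico (max s τ) t))) := by
      have hc : Integrable (fun _ : ℝ => 2 * M * C) (volume.restrict (Ico (max s τ) t)) :=
        integrableOn_const (by simp)
      refine ((integrableOn_exp_wait hM0 τ τ).mul_prod hc).mono' ?_ (ae_of_all _ fun p => ?_)
      · refine Measurable.aestronglyMeasurable (Measurable.mul (by fun_prop) ?_)
        exact (hDm.comp measurable_snd).indicator (s := {p : ℝ × ℝ | p.2 < p.1})
          (measurableSet_lt measurable_snd measurable_fst)
      · rw [norm_mul, Real.norm_eq_abs, abs_of_nonneg (by positivity)]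
        refine mul_le_mul_of_nonneg_left ?_ (by positivity)
        refine (norm_indicator_le_norm_self _ _).trans (hDb _)
    rw [integral_integral_swap hint]
    refine setIntegral_congr_fun measurableSet_Ico fun v hv => ?_
    have hτv : τ ≤ v := (le_max_right _ _).trans hv.1
    have h2 : ∀ r, M * Real.exp (-M * (r - τ)) * indicator (Iio r) D v =
        indicator (Ioi v) (fun r => M * Real.exp (-M * (r - τ)) * D v) r := fun r => by
      by_cases h : v < r <;> simp [indicator, h]
    simp only [h2]
    rw [setIntegral_indicator measurableSet_Ioi, Ioi_inter_Ioi, sup_eq_right.2 hτv,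
      integral_mul_const, integral_exp_wait hM0]
  rw [hsplit, hA, hB, sub_self]

end JumpKernel

/-! ### The uniformised chain -/

section Chain

variable {S : Type*} [Countable S] [TopologicalSpace S] [DiscreteTopology S]
    [MeasurableSpace S] [DiscreteMeasurableSpace S]
    {U : S → Type*} [∀ i, TopologicalSpace (U i)] [∀ i, MeasurableSpace (U i)]
    [∀ i, BorelSpace (U i)] {lam : (i : S) → S → U i → ℝ} {u : MarkovControl U} {M : ℝ}

lemma measurable_history_next (n : ℕ) : Measurable fun ω : ℕ → ℝ × S =>
    (Preorder.frestrictLe (π := fun _ => ℝ × S) n ω, ω (n + 1)) :=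
  (Preorder.measurable_frestrictLe n).prodMk (measurable_pi_apply _)

/-- The jump kernel, as a kernel from histories of length `n`: only the last point matters. -/
noncomputable def chainKernel (lam : (i : S) → S → U i → ℝ) (u : MarkovControl U) (M : ℝ) (n : ℕ) :
    Kernel (Π _ : Finset.Iic n, ℝ × S) (ℝ × S) :=
  (jumpKernel lam u M).comap (fun h => h ⟨n, Finset.mem_Iic.2 le_rfl⟩) (measurable_pi_apply _)

/-- The law of the uniformised chain of (jump time, state) pairs started from `(0, i)`. -/
noncomputable def chainLaw (lam : (i : S) → S → U i → ℝ) (u : MarkovControl U) (M : ℝ) (i : S)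
    [∀ n, IsMarkovKernel (chainKernel lam u M n)] : Measure (ℕ → ℝ × S) :=
  Kernel.traj (X := fun _ => ℝ × S) (chainKernel lam u M) 0 fun _ => (0, i)

instance [IsMarkovKernel (jumpKernel lam u M)] (n : ℕ) :
    IsMarkovKernel (chainKernel lam u M n) := by
  unfold chainKernel
  infer_instance

variable [IsMarkovKernel (jumpKernel lam u M)] {i : S}

instance : IsProbabilityMeasure (chainLaw lam u M i) := by
  unfold chainLaw
  infer_instance

lemma chainLaw_map_succ (n : ℕ) :
    (chainLaw lam u M i).map
      (fun ω => (Preorder.frestrictLe (π := fun _ => ℝ × S) n ω, ω (n + 1))) =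
      ((chainLaw lam u M i).map (Preorder.frestrictLe n)) ⊗ₘ chainKernel lam u M n := by
  rw [chainLaw, Kernel.traj_map_frestrictLe_apply]
  exact (Kernel.partialTraj_compProd_eq_map_traj (X := fun _ => ℝ × S) (Nat.zero_le n)).symm

lemma ae_chainLaw_zero : ∀ᵐ ω ∂(chainLaw lam u M i), ω 0 = (0, i) := by
  have h := Kernel.traj_map_frestrictLe_apply (X := fun _ => ℝ × S) (κ := chainKernel lam u M) 0 0
    (fun _ => (0, i))
  rw [Kernel.partialTraj_self, Kernel.id_apply] at h
  have h1 : ∀ᵐ x ∂((chainLaw lam u M i).map (Preorder.frestrictLe (π := fun _ => ℝ × S) 0)),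
      x ⟨0, Finset.mem_Iic.2 le_rfl⟩ = (0, i) := by
    rw [chainLaw, h, ae_dirac_iff (measurableSet_eq_fun (measurable_pi_apply _) measurable_const)]
  exact ae_of_ae_map (by fun_prop) h1

lemma ae_chainLaw_succ {p : ℝ × S → ℝ × S → Prop}
    (hp : MeasurableSet {q : (ℝ × S) × (ℝ × S) | p q.1 q.2})
    (h : ∀ x, ∀ᵐ x' ∂(jumpKernel lam u M x), p x x') (n : ℕ) :
    ∀ᵐ ω ∂(chainLaw lam u M i), p (ω n) (ω (n + 1)) := by
  have h1 : ∀ᵐ q ∂((chainLaw lam u M i).map (Preorder.frestrictLe n)) ⊗ₘ chainKernel lam u M n,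
      p (q.1 ⟨n, Finset.mem_Iic.2 le_rfl⟩) q.2 := by
    refine (Measure.ae_compProd_iff ?_).2 (ae_of_all _ fun h' => h _)
    exact hp.preimage (f := fun q : (Π _ : Finset.Iic n, ℝ × S) × (ℝ × S) =>
      (q.1 ⟨n, Finset.mem_Iic.2 le_rfl⟩, q.2)) (Measurable.prodMk
        ((measurable_pi_apply _).comp measurable_fst) measurable_snd)
  rw [← chainLaw_map_succ] at h1
  exact ae_of_ae_map (f := fun ω => (Preorder.frestrictLe (π := fun _ => ℝ × S) n ω, ω (n + 1)))
    (by fun_prop) h1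

lemma lintegral_chainLaw_succ {F : ℝ × S → ENNReal} (hF : Measurable F) (n : ℕ) :
    ∫⁻ ω, F (ω (n + 1)) ∂(chainLaw lam u M i) =
      ∫⁻ ω, ∫⁻ x', F x' ∂(jumpKernel lam u M (ω n)) ∂(chainLaw lam u M i) := by
  have h1 : ∫⁻ ω, F (ω (n + 1)) ∂(chainLaw lam u M i) = ∫⁻ q, F q.2 ∂((chainLaw lam u M i).map
      (fun ω => (Preorder.frestrictLe (π := fun _ => ℝ × S) n ω, ω (n + 1)))) :=
    (lintegral_map (f := fun q : (Π _ : Finset.Iic n, ℝ × S) × (ℝ × S) => F q.2)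
      (hF.comp measurable_snd) (measurable_history_next n)).symm
  have hF' : Measurable fun q : (Π _ : Finset.Iic n, ℝ × S) × (ℝ × S) => F q.2 :=
    hF.comp measurable_snd
  rw [h1, chainLaw_map_succ, Measure.lintegral_compProd hF',
    lintegral_map (Measurable.lintegral_kernel_prod_right' hF')
      (Preorder.measurable_frestrictLe n)]
  rfl

/-- Step functions of conditional mean zero integrate to zero over events of the past. -/
lemma integral_chainLaw_succ_eq_zero {H : ℝ × S → ℝ × S → ℝ}
    (hH : Measurable fun q : (ℝ × S) × (ℝ × S) => H q.1 q.2) {C : ℝ} (hC : ∀ x x', |H x x'| ≤ C)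
    (h0 : ∀ x, ∫ x', H x x' ∂(jumpKernel lam u M x) = 0) (n : ℕ)
    {B : Set (Π _ : Finset.Iic n, ℝ × S)} (hB : MeasurableSet B) :
    ∫ ω, indicator (Preorder.frestrictLe (π := fun _ => ℝ × S) n ⁻¹' B)
      (fun ω => H (ω n) (ω (n + 1))) ω ∂(chainLaw lam u M i) = 0 := by
  let G : (Π _ : Finset.Iic n, ℝ × S) × (ℝ × S) → ℝ := fun q =>
    indicator (Prod.fst ⁻¹' B) (fun q => H (q.1 ⟨n, Finset.mem_Iic.2 le_rfl⟩) q.2) q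
  have hG : Measurable G := by
    refine Measurable.indicator ?_ (measurable_fst hB)
    exact hH.comp (f := fun q : (Π _ : Finset.Iic n, ℝ × S) × (ℝ × S) =>
      (q.1 ⟨n, Finset.mem_Iic.2 le_rfl⟩, q.2)) (by fun_prop)
  have hGb : ∀ q, |G q| ≤ C := fun q =>
    (norm_indicator_le_norm_self (fun q : (Π _ : Finset.Iic n, ℝ × S) × (ℝ × S) =>
      H (q.1 ⟨n, Finset.mem_Iic.2 le_rfl⟩) q.2) q).trans (hC _ _)
  have h1 : ∫ ω, indicator (Preorder.frestrictLe (π := fun _ => ℝ × S) n ⁻¹' B)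
      (fun ω => H (ω n) (ω (n + 1))) ω ∂(chainLaw lam u M i) = ∫ q, G q ∂((chainLaw lam u M i).map
      (fun ω => (Preorder.frestrictLe (π := fun _ => ℝ × S) n ω, ω (n + 1)))) :=
    (integral_map (f := G) (measurable_history_next n).aemeasurable hG.aestronglyMeasurable).symm
  have : IsProbabilityMeasure ((chainLaw lam u M i).map
    (Preorder.frestrictLe (π := fun _ => ℝ × S) n)) :=
    Measure.isProbabilityMeasure_map (by fun_prop)
  rw [h1, chainLaw_map_succ, Measure.integral_compProd
    (Integrable.of_bound hG.aestronglyMeasurable C (ae_of_all _ hGb))]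
  refine integral_eq_zero_of_ae (ae_of_all _ fun h => ?_)
  change ∫ x', G (h, x') ∂(jumpKernel lam u M (h ⟨n, Finset.mem_Iic.2 le_rfl⟩)) = 0
  by_cases hh : h ∈ B
  · simp only [G, indicator, mem_preimage, hh, if_true]
    exact h0 _
  · simp [G, indicator, mem_preimage, hh]

/-- A realisation of the chain is regular if it starts from `(0, i)` and its jump times increase
strictly to infinity. -/
def IsRegularChain (i : S) (ω : ℕ → ℝ × S) : Prop :=
  ω 0 = (0, i) ∧ StrictMono (fun n => (ω n).1) ∧ Tendsto (fun n => (ω n).1) atTop atTop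

lemma lintegral_exp_neg_chainLaw (hlam : IsRateFamily lam) (hM0 : 0 < M)
    (hM : ∀ i v, -lam i i v ≤ M) (n : ℕ) :
    ∫⁻ ω, ENNReal.ofReal (Real.exp (-(ω n).1)) ∂(chainLaw lam u M i) =
      ENNReal.ofReal (M / (M + 1)) ^ n := by
  induction n with
  | zero =>
    rw [lintegral_congr_ae (g := fun _ => 1) (by
      filter_upwards [ae_chainLaw_zero] with ω hω
      simp [hω])]
    simp
  | succ n ih =>
    rw [lintegral_chainLaw_succ (F := fun x => ENNReal.ofReal (Real.exp (-x.1))) (by fun_prop)]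
    simp only [lintegral_exp_neg_jumpKernel hlam hM0 hM]
    rw [lintegral_const_mul _ (by fun_prop), ih, pow_succ']

/-- The jump times `T_n` tend to infinity because `∑ E[exp(-T_n)]` is a convergent geometric
series. -/
lemma ae_isRegularChain (hlam : IsRateFamily lam) (hM0 : 0 < M)
    (hM : ∀ i v, -lam i i v ≤ M) : ∀ᵐ ω ∂(chainLaw lam u M i), IsRegularChain i ω := by
  have hmono : ∀ᵐ ω ∂(chainLaw lam u M i), ∀ n, (ω n).1 < (ω (n + 1)).1 :=
    ae_all_iff.2 fun n => ae_chainLaw_succ (p := fun x x' => x.1 < x'.1)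
      (measurableSet_lt (by fun_prop) (by fun_prop)) (ae_lt_jumpKernel hlam hM0 hM) n
  have hsum : ∫⁻ ω, ∑' n, ENNReal.ofReal (Real.exp (-(ω n).1)) ∂(chainLaw lam u M i) ≠ ⊤ := by
    rw [lintegral_tsum (fun n => (by fun_prop :
      Measurable fun ω : ℕ → ℝ × S => ENNReal.ofReal (Real.exp (-(ω n).1))).aemeasurable)]
    simp only [lintegral_exp_neg_chainLaw hlam hM0 hM]
    rw [ENNReal.tsum_geometric]
    have : ENNReal.ofReal (M / (M + 1)) < 1 := by
      rw [ENNReal.ofReal_lt_one, div_lt_one (by positivity)]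
      linarith
    exact ENNReal.inv_ne_top.2 (tsub_pos_of_lt this).ne'
  filter_upwards [ae_chainLaw_zero, hmono, ae_lt_top (by fun_prop) hsum] with ω h0 h1 h2
  refine ⟨h0, strictMono_nat_of_lt_succ h1, ?_⟩
  have h3 := ENNReal.tendsto_atTop_zero_of_tsum_ne_top h2.ne
  have h4 : Tendsto (fun n => Real.exp (-(ω n).1)) atTop (𝓝 0) := by
    have := (ENNReal.tendsto_toReal ENNReal.zero_ne_top).comp h3
    refine this.congr fun n => ?_
    simp [ENNReal.toReal_ofReal (Real.exp_pos _).le]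
  rw [Real.tendsto_exp_comp_nhds_zero] at h4
  exact tendsto_neg_atBot_iff.1 h4

lemma measurableSet_isRegularChain : MeasurableSet {ω : ℕ → ℝ × S | IsRegularChain i ω} := by
  have e : {ω : ℕ → ℝ × S | IsRegularChain i ω} = {ω | ω 0 = (0, i)} ∩
      ((⋂ n : ℕ, {ω | (ω n).1 < (ω (n + 1)).1}) ∩
        ⋂ k : ℕ, ⋃ n : ℕ, {ω : ℕ → ℝ × S | (k : ℝ) ≤ (ω n).1}) := by
    ext ω
    simp only [mem_inter_iff, mem_iInter, mem_iUnion, mem_ofPred_eq]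
    refine and_congr_right fun _ => ⟨fun h => ⟨fun n => h.1 n.lt_succ_self, fun k =>
      (h.2.eventually_ge_atTop (k : ℝ)).exists⟩, fun h => ?_⟩
    have hm : StrictMono fun n => (ω n).1 := strictMono_nat_of_lt_succ h.1
    refine ⟨hm, tendsto_atTop_atTop_of_monotone hm.monotone fun b => ?_⟩
    obtain ⟨k, hk⟩ := exists_nat_ge b
    obtain ⟨n, hn⟩ := h.2 k
    exact ⟨n, hk.trans hn⟩
  rw [e]
  refine (measurableSet_eq_fun (measurable_pi_apply _) measurable_const).inter
    ((MeasurableSet.iInter fun n => measurableSet_lt (by fun_prop) (by fun_prop)).inter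
      (MeasurableSet.iInter fun k => MeasurableSet.iUnion fun n =>
        measurableSet_le measurable_const (by fun_prop)))

end Chain

/-! ### Paths of the uniformised chain -/

section ChainPath

variable {S : Type*} {i : S} {ω : ℕ → ℝ × S}

namespace IsRegularChain

lemma exists_holding (h : IsRegularChain i ω) {r : ℝ} (hr : 0 ≤ r) :
    ∃ k, (ω k).1 ≤ r ∧ r < (ω (k + 1)).1 := by
  classical
  have hex : ∃ n, r < (ω n).1 := (h.2.2.eventually_gt_atTop r).exists
  obtain ⟨k, hk⟩ : ∃ k, Nat.find hex = k + 1 := by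
    refine Nat.exists_eq_succ_of_ne_zero fun h0 => ?_
    have := Nat.find_spec hex
    rw [h0, h.1] at this
    exact absurd this (not_lt.2 hr)
  refine ⟨k, not_lt.1 (Nat.find_min hex (by omega)), ?_⟩
  rw [← hk]
  exact Nat.find_spec hex

lemma exists_holding_left (h : IsRegularChain i ω) {r : ℝ} (hr : 0 < r) :
    ∃ k, (ω k).1 < r ∧ r ≤ (ω (k + 1)).1 := by
  classical
  have hex : ∃ n, r ≤ (ω n).1 := (h.2.2.eventually_ge_atTop r).exists
  obtain ⟨k, hk⟩ : ∃ k, Nat.find hex = k + 1 := by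
    refine Nat.exists_eq_succ_of_ne_zero fun h0 => ?_
    have := Nat.find_spec hex
    rw [h0, h.1] at this
    exact absurd hr (not_lt.2 this)
  refine ⟨k, not_le.1 (Nat.find_min hex (by omega)), ?_⟩
  rw [← hk]
  exact Nat.find_spec hex

end IsRegularChain

open Classical in
/-- The right-continuous step function that takes the value `Y_k` on `[T_k, T_{k+1})`, for a
realisation `(T_k, Y_k)` of the chain; it is constant if the realisation is not regular. -/
noncomputable def chainPathFun (i : S) (ω : ℕ → ℝ × S) (r : ℝ≥0) : S :=
  if IsRegularChain i ω then (ω (sInf {k | (r : ℝ) < (ω (k + 1)).1})).2 else i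

lemma IsRegularChain.chainPathFun_eq (h : IsRegularChain i ω) {k : ℕ} {r : ℝ≥0}
    (h1 : (ω k).1 ≤ r) (h2 : r < (ω (k + 1)).1) : chainPathFun i ω r = (ω k).2 := by
  rw [chainPathFun, if_pos h]
  congr 2
  refine le_antisymm (Nat.sInf_le h2) (le_csInf ⟨k, h2⟩ fun j hj => ?_)
  by_contra hjk
  have : (ω (j + 1)).1 ≤ (ω k).1 := h.2.1.monotone (not_le.1 hjk)
  exact absurd (this.trans h1) (not_le.2 hj)

variable [TopologicalSpace S]

/-- The càdlàg path of a realisation of the uniformised chain. -/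
noncomputable def chainPath (i : S) (ω : ℕ → ℝ × S) : CadlagPath S :=
  ⟨chainPathFun i ω, by
    by_cases h : IsRegularChain i ω
    · refine ⟨fun t => ?_, fun t ht => ?_⟩
      · obtain ⟨k, h1, h2⟩ := h.exists_holding t.2
        refine Tendsto.congr' (f₁ := fun _ => (ω k).2) ?_ ?_
        · have : ∀ᶠ r : ℝ≥0 in 𝓝[≥] t, (r : ℝ) < (ω (k + 1)).1 :=
            (NNReal.continuous_coe.continuousAt.eventually_lt continuousAt_const h2).filter_mono
              nhdsWithin_le_nhds
          filter_upwards [this, self_mem_nhdsWithin] with r hr hr'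
          exact (h.chainPathFun_eq (h1.trans hr') hr).symm
        · rw [h.chainPathFun_eq h1 h2]
          exact tendsto_const_nhds
      · obtain ⟨k, h1, h2⟩ := h.exists_holding_left (r := t) ht
        refine ⟨(ω k).2, Tendsto.congr' (f₁ := fun _ => (ω k).2) ?_ tendsto_const_nhds⟩
        have : ∀ᶠ r : ℝ≥0 in 𝓝[<] t, (ω k).1 < r :=
          (continuousAt_const.eventually_lt NNReal.continuous_coe.continuousAt h1).filter_mono
            nhdsWithin_le_nhds
        filter_upwards [this, self_mem_nhdsWithin] with r hr hr'
        exact (h.chainPathFun_eq hr.le (lt_of_lt_of_le hr' h2)).symm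
    · have : chainPathFun i ω = fun _ => i := by
        funext r
        rw [chainPathFun, if_neg h]
      rw [this]
      exact ⟨fun t => continuousWithinAt_const, fun t _ => ⟨i, tendsto_const_nhds⟩⟩⟩

lemma IsRegularChain.chainPath_X (h : IsRegularChain i ω) {k : ℕ} {r : ℝ≥0}
    (h1 : (ω k).1 ≤ r) (h2 : r < (ω (k + 1)).1) : (chainPath i ω).X r = (ω k).2 :=
  h.chainPathFun_eq h1 h2

lemma chainPath_X_of_not (h : ¬ IsRegularChain i ω) (r : ℝ≥0) : (chainPath i ω).X r = i := by
  change chainPathFun i ω r = i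
  rw [chainPathFun, if_neg h]

lemma IsRegularChain.chainPath_X_mem_iff (h : IsRegularChain i ω) (r : ℝ≥0) (A : Set S) :
    (chainPath i ω).X r ∈ A ↔ ∃ k, (ω k).1 ≤ r ∧ r < (ω (k + 1)).1 ∧ (ω k).2 ∈ A := by
  constructor
  · intro hA
    obtain ⟨k, h1, h2⟩ := h.exists_holding r.2
    exact ⟨k, h1, h2, h.chainPath_X h1 h2 ▸ hA⟩
  · rintro ⟨k, h1, h2, hA⟩
    rwa [h.chainPath_X h1 h2]

variable [MeasurableSpace S] [Countable S] [DiscreteTopology S] [DiscreteMeasurableSpace S]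

lemma measurable_chainPath : Measurable (chainPath i) := by
  refine measurable_iff_le_map.2 (iSup_le fun r => ?_)
  rintro _ ⟨E, -, rfl⟩
  have hrw : chainPath i ⁻¹' (CadlagPath.X r ⁻¹' E) =
      ({ω | IsRegularChain i ω} ∩ ⋃ k : ℕ, {ω | (ω k).1 ≤ r ∧ r < (ω (k + 1)).1 ∧ (ω k).2 ∈ E}) ∪
      ({ω | IsRegularChain i ω}ᶜ ∩ {_ω | i ∈ E}) := by
    ext ω
    by_cases h : IsRegularChain i ω
    · simp [h, h.chainPath_X_mem_iff]
    · simp [h, chainPath_X_of_not h]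
  change MeasurableSet (chainPath i ⁻¹' (CadlagPath.X r ⁻¹' E))
  rw [hrw]
  refine (measurableSet_isRegularChain.inter (MeasurableSet.iUnion fun k => ?_)).union
    (measurableSet_isRegularChain.compl.inter (.const _))
  have hT : ∀ n : ℕ, Measurable fun ω : ℕ → ℝ × S => (ω n).1 := fun n => by fun_prop
  refine (measurableSet_le (hT k) measurable_const).inter
    ((measurableSet_lt measurable_const (hT (k + 1))).inter ?_)
  exact (MeasurableSet.of_discrete (s := E)).preimage (measurable_snd.comp (measurable_pi_apply k))

/-- Before the `n + 1`-st jump time, an event that depends on the path up to time `s` is determined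
by the first `n` jumps. -/
lemma exists_history_event {s : ℝ≥0} {A : Set (CadlagPath S)}
    (hA : MeasurableSet[CadlagPath.filtration S s] A) (n : ℕ) :
    ∃ B : Set (Π _ : Finset.Iic n, ℝ × S), MeasurableSet B ∧
      ∀ ω, IsRegularChain i ω → s < (ω (n + 1)).1 →
        (chainPath i ω ∈ A ↔ Preorder.frestrictLe (π := fun _ => ℝ × S) n ω ∈ B) := by
  let D : Set (ℕ → ℝ × S) := {ω | IsRegularChain i ω ∧ s < (ω (n + 1)).1}
  let m : MeasurableSpace D := MeasurableSpace.comap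
    (fun ω : D => Preorder.frestrictLe (π := fun _ => ℝ × S) n ω.1) inferInstance
  have hle : CadlagPath.filtration S s ≤ m.map (fun ω : D => chainPath i ω.1) := by
    refine iSup₂_le fun r hr => ?_
    rintro _ ⟨E, -, rfl⟩
    have hrw : (fun ω : D => chainPath i ω.1) ⁻¹' (CadlagPath.X r ⁻¹' E) =
        (fun ω : D => Preorder.frestrictLe (π := fun _ => ℝ × S) n ω.1) ⁻¹'
          (⋃ k : Finset.Iic n, {h | (h k).1 ≤ r} ∩ ({h | ∀ l : Finset.Iic n, l.1 = k.1 + 1 →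
            r < (h l).1} ∩ {h | (h k).2 ∈ E})) := by
      ext ⟨ω, hω, hs⟩
      simp only [mem_preimage, mem_iUnion, mem_inter_iff, mem_ofPred_eq]
      rw [hω.chainPath_X_mem_iff]
      constructor
      · rintro ⟨k, h1, h2, h3⟩
        have hk : k ≤ n := by
          by_contra hk
          have : (ω (n + 1)).1 ≤ (ω k).1 := hω.2.1.monotone (not_le.1 hk)
          have hr' : (r : ℝ) ≤ s := hr
          linarith
        refine ⟨⟨k, Finset.mem_Iic.2 hk⟩, h1, ?_, h3⟩
        rintro ⟨l, hl⟩ (rfl : l = k + 1)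
        exact h2
      · rintro ⟨⟨k, hk⟩, h1, h2, h3⟩
        refine ⟨k, h1, ?_, h3⟩
        rcases (Finset.mem_Iic.1 hk).lt_or_eq with hlt | rfl
        · exact h2 ⟨k + 1, Finset.mem_Iic.2 hlt⟩ rfl
        · exact lt_of_le_of_lt hr hs
    change MeasurableSet[m] ((fun ω : D => chainPath i ω.1) ⁻¹' (CadlagPath.X r ⁻¹' E))
    rw [hrw]
    refine ⟨_, ?_, rfl⟩
    refine MeasurableSet.iUnion fun k => (measurableSet_le (by fun_prop) measurable_const).inter
      (MeasurableSet.inter ?_ ?_)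
    · simp only [ofPred_forall]
      exact MeasurableSet.iInter fun l => MeasurableSet.iInter fun _ =>
        measurableSet_lt measurable_const (by fun_prop)
    · exact (MeasurableSet.of_discrete (s := E)).preimage
        (measurable_snd.comp (measurable_pi_apply k))
  obtain ⟨B, hB, hBA⟩ := hle A hA
  refine ⟨B, hB, fun ω hω hs => ?_⟩
  exact (Set.ext_iff.1 hBA (⟨ω, hω, hs⟩ : D)).symm

end ChainPath

/-! ### Existence for the martingale problem -/

section Existence

variable {S : Type*} [Countable S] [TopologicalSpace S] [DiscreteTopology S]
    [MeasurableSpace S] [DiscreteMeasurableSpace S]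
    {U : S → Type*} [∀ i, TopologicalSpace (U i)] [∀ i, MeasurableSpace (U i)]
    [∀ i, BorelSpace (U i)] {lam : (i : S) → S → U i → ℝ} {u : MarkovControl U} {M : ℝ}

/-- The process `f(X_t) - ∫₀ᵗ Λ_s f(X_s) ds` of the martingale problem. -/
noncomputable def dynkinCompensated (lam : (i : S) → S → U i → ℝ) (u : MarkovControl U) (f : S → ℝ)
    (t : ℝ≥0) (ω : CadlagPath S) : ℝ :=
  f (ω.X t) - ∫ s in (0 : ℝ)..t, controlledGenerator lam u s.toNNReal f (ω.X s.toNNReal)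

lemma stronglyMeasurable_dynkinCompensated (hlam : IsRateFamily lam) {f : S → ℝ} {C : ℝ}
    (hf : ∀ j, |f j| ≤ C) (t : ℝ≥0) :
    StronglyMeasurable[CadlagPath.filtration S t] (dynkinCompensated lam u f t) := by
  have h1 : StronglyMeasurable[CadlagPath.filtration S t] fun ω : CadlagPath S => f (ω.X t) :=
    ((Measurable.of_discrete (f := f)).comp
      (CadlagPath.measurable_filtration_X le_rfl)).stronglyMeasurable
  exact h1.sub (CadlagPath.stronglyMeasurable_filtration_integral
    (b := fun r => controlledGenerator lam u r.toNNReal f)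
    (measurable_controlledGenerator hlam u hf) t)

lemma abs_dynkinCompensated_le (hlam : IsRateFamily lam) (hM : ∀ i v, -lam i i v ≤ M) {f : S → ℝ}
    {C : ℝ} (hf : ∀ j, |f j| ≤ C) (t : ℝ≥0) (ω : CadlagPath S) :
    |dynkinCompensated lam u f t ω| ≤ C + 2 * M * C * t := by
  refine (abs_sub _ _).trans (add_le_add (hf _) ?_)
  have := intervalIntegral.norm_integral_le_of_norm_le_const (a := (0 : ℝ)) (b := t)
    (f := fun s : ℝ => controlledGenerator lam u s.toNNReal f (ω.X s.toNNReal)) (C := 2 * M * C)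
    fun r _ => hlam.abs_tsum_le hM hf _ _
  rwa [sub_zero, abs_of_nonneg t.coe_nonneg] at this

/-- On a regular realisation the step contributions are the increments of the Dynkin process along
the times `T_n` clipped to `[s, t]`. -/
lemma IsRegularChain.jumpIncrement_eq (hlam : IsRateFamily lam) {f : S → ℝ} {C : ℝ}
    (hf : ∀ j, |f j| ≤ C) {i : S} {ω : ℕ → ℝ × S} (h : IsRegularChain i ω) {s t : ℝ≥0}
    (hst : s ≤ t) (n : ℕ) :
    jumpIncrement lam u f s t (ω n) (ω (n + 1)) =
      dynkinCompensated lam u f (max s (min t (ω (n + 1)).1.toNNReal)) (chainPath i ω) -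
      dynkinCompensated lam u f (max s (min t (ω n).1.toNNReal)) (chainPath i ω) := by
  obtain ⟨M, hM0, hM⟩ := hlam.exists_bound
  have hlt : (ω n).1 < (ω (n + 1)).1 := h.2.1 n.lt_succ_self
  have hT0 : ∀ k, 0 ≤ (ω k).1 := fun k => by
    have := h.2.1.monotone (Nat.zero_le k)
    simpa [h.1] using this
  set x := ω n with hx
  set x' := ω (n + 1) with hx'
  have hst' : (s : ℝ) ≤ t := hst
  rcases le_or_gt x'.1 s with h1 | h1
  · -- both clipped times equal `s`
    have e1 : max s (min t x'.1.toNNReal) = s :=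
      max_eq_left ((min_le_right _ _).trans (Real.toNNReal_le_iff_le_coe.2 h1))
    have e2 : max s (min t x.1.toNNReal) = s :=
      max_eq_left ((min_le_right _ _).trans (Real.toNNReal_le_iff_le_coe.2 (hlt.le.trans h1)))
    rw [e1, e2, sub_self, jumpIncrement, indicator_of_notMem (fun hh => absurd hh.1 (not_lt.2 h1)),
      Ico_eq_empty (not_lt.2 ((min_le_right _ _).trans (h1.trans (le_max_left _ _))))]
    simp
  rcases lt_or_ge (t : ℝ) x.1 with h2 | h2
  · -- both clipped times equal `t`
    have e1 : max s (min t x'.1.toNNReal) = t := by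
      rw [min_eq_left (Real.le_toNNReal_iff_coe_le (hT0 _) |>.2 (h2.le.trans hlt.le)),
        max_eq_right hst]
    have e2 : max s (min t x.1.toNNReal) = t := by
      rw [min_eq_left (Real.le_toNNReal_iff_coe_le (hT0 _) |>.2 h2.le), max_eq_right hst]
    rw [e1, e2, sub_self, jumpIncrement,
      indicator_of_notMem (fun hh => absurd (hh.2.trans h2.le) (not_le.2 hlt)),
      Ico_eq_empty (not_lt.2 ((min_le_left _ _).trans (h2.le.trans (le_max_right _ _))))]
    simp
  -- the holding interval `[T_n, T_{n+1})` meets `[s, t]`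
  set a : ℝ≥0 := max s (min t x.1.toNNReal) with ha
  set b : ℝ≥0 := max s (min t x'.1.toNNReal) with hb
  have ha' : (a : ℝ) = max (s : ℝ) x.1 := by
    rw [ha, min_eq_right (Real.toNNReal_le_iff_le_coe.2 h2), NNReal.coe_max,
      Real.coe_toNNReal _ (hT0 n)]
  have hb' : (b : ℝ) = min (t : ℝ) x'.1 := by
    rw [hb, NNReal.coe_max, NNReal.coe_min, Real.coe_toNNReal _ (hT0 (n + 1)),
      max_eq_right (le_min hst' h1.le)]
  have hab : (a : ℝ) ≤ b := by
    rw [ha', hb']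
    exact max_le (le_min hst' h1.le) (le_min h2 hlt.le)
  have hXa : (chainPath i ω).X a = x.2 := h.chainPath_X (by rw [ha']; exact le_max_right _ _)
    (by rw [ha']; exact max_lt h1 hlt)
  have hII : ∀ c d : ℝ, IntervalIntegrable (fun r => controlledGenerator lam u r.toNNReal f
      ((chainPath i ω).X r.toNNReal)) volume c d := fun c d =>
    CadlagPath.intervalIntegrable (b := fun r => controlledGenerator lam u r.toNNReal f)
      (measurable_controlledGenerator hlam u hf) (fun r _ j => hlam.abs_tsum_le hM hf j _) _
  have hint : ∫ v in Ico (max (s : ℝ) x.1) (min (t : ℝ) x'.1),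
        controlledGenerator lam u v.toNNReal f x.2 =
      ∫ v in (a : ℝ)..b, controlledGenerator lam u v.toNNReal f ((chainPath i ω).X v.toNNReal) := by
    rw [intervalIntegral.integral_of_le hab, integral_Ioc_eq_integral_Ioo,
      ← integral_Ico_eq_integral_Ioo, ha', hb']
    refine setIntegral_congr_fun measurableSet_Ico fun v hv => ?_
    have hv0 : 0 ≤ v := s.2.trans ((le_max_left _ _).trans hv.1)
    have hXv : (chainPath i ω).X v.toNNReal = x.2 := h.chainPath_X
      (by rw [Real.coe_toNNReal _ hv0]; exact (le_max_right _ _).trans hv.1)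
      (by rw [Real.coe_toNNReal _ hv0]; exact hv.2.trans_le (min_le_right _ _))
    simp only [hXv]
  have hjump : indicator (Ioc (s : ℝ) t) (fun _ => f x'.2 - f x.2) x'.1 =
      f ((chainPath i ω).X b) - f x.2 := by
    rcases le_or_gt x'.1 t with h3 | h3
    · have hXb : (chainPath i ω).X b = x'.2 :=
        h.chainPath_X (by rw [hb']; exact (min_eq_right h3).ge)
          (by rw [hb', min_eq_right h3]; exact h.2.1 (n + 1).lt_succ_self)
      rw [indicator_of_mem (show x'.1 ∈ Ioc (s : ℝ) t from ⟨h1, h3⟩), hXb]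
    · have hXb : (chainPath i ω).X b = x.2 :=
        h.chainPath_X (by rw [hb', min_eq_left h3.le]; exact h2)
          (by rw [hb', min_eq_left h3.le]; exact h3)
      rw [indicator_of_notMem (fun hh => absurd hh.2 (not_le.2 h3)), hXb, sub_self]
  rw [jumpIncrement, hjump, hint,
    ← intervalIntegral.integral_interval_sub_left (hII 0 b) (hII 0 a)]
  simp only [dynkinCompensated, hXa]
  ring

/-- The law of the path of the uniformised chain started from `i`. -/
noncomputable def chainPathLaw (lam : (i : S) → S → U i → ℝ) (u : MarkovControl U) (M : ℝ) (i : S)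
    [IsMarkovKernel (jumpKernel lam u M)] : Measure (CadlagPath S) :=
  (chainLaw lam u M i).map (chainPath i)

variable [IsMarkovKernel (jumpKernel lam u M)] {i : S}

instance : IsProbabilityMeasure (chainPathLaw lam u M i) :=
  Measure.isProbabilityMeasure_map measurable_chainPath.aemeasurable

/-- If the step ends before `s` its contribution vanishes; otherwise `A` is an event of the first
`n` jumps, over which the contribution has mean zero. -/
lemma setIntegral_jumpIncrement_eq_zero (hlam : IsRateFamily lam) (hM0 : 0 < M)
    (hM : ∀ i v, -lam i i v ≤ M) {f : S → ℝ} {C : ℝ} (hf : ∀ j, |f j| ≤ C) {s t : ℝ≥0}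
    (hst : s ≤ t) {A : Set (CadlagPath S)} (hA : MeasurableSet[CadlagPath.filtration S s] A)
    (n : ℕ) :
    ∫ ω in chainPath i ⁻¹' A, jumpIncrement lam u f s t (ω n) (ω (n + 1)) ∂(chainLaw lam u M i) =
      0 := by
  obtain ⟨B, hB, hBA⟩ := exists_history_event (i := i) hA n
  have hA' : MeasurableSet (chainPath i ⁻¹' A) :=
    measurable_chainPath ((CadlagPath.filtration S).le s A hA)
  rw [← integral_indicator hA', ← integral_chainLaw_succ_eq_zero (lam := lam) (u := u) (i := i)
    (measurable_jumpIncrement (u := u) hlam hf s t) (abs_jumpIncrement_le hlam hM0 hM hf hst)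
    (integral_jumpIncrement hlam hM0 hM hf hst) n hB]
  refine integral_congr_ae ?_
  filter_upwards [ae_isRegularChain hlam hM0 hM] with ω hω
  rcases lt_or_ge (s : ℝ) (ω (n + 1)).1 with h1 | h1
  · have hiff : ω ∈ chainPath i ⁻¹' A ↔ ω ∈ Preorder.frestrictLe n ⁻¹' B := hBA ω hω h1
    by_cases hA : ω ∈ chainPath i ⁻¹' A
    · rw [indicator_of_mem hA, indicator_of_mem (hiff.1 hA)]
    · rw [indicator_of_notMem hA, indicator_of_notMem (mt hiff.2 hA)]
  · have h0 : jumpIncrement lam u f s t (ω n) (ω (n + 1)) = 0 := by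
      rw [jumpIncrement, indicator_of_notMem (fun hh => absurd hh.1 (not_lt.2 h1)),
        Ico_eq_empty (not_lt.2 ((min_le_right _ _).trans (h1.trans (le_max_left _ _))))]
      simp
    simp [indicator, h0]

lemma setIntegral_dynkinCompensated (hlam : IsRateFamily lam) (hM0 : 0 < M)
    (hM : ∀ i v, -lam i i v ≤ M) {f : S → ℝ} {C : ℝ} (hf : ∀ j, |f j| ≤ C) {s t : ℝ≥0}
    (hst : s ≤ t) {A : Set (CadlagPath S)} (hA : MeasurableSet[CadlagPath.filtration S s] A) :
    ∫ ω in A, dynkinCompensated lam u f s ω ∂(chainPathLaw lam u M i) =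
      ∫ ω in A, dynkinCompensated lam u f t ω ∂(chainPathLaw lam u M i) := by
  have hAm : MeasurableSet A := (CadlagPath.filtration S).le s A hA
  have hZm : ∀ r, StronglyMeasurable (dynkinCompensated lam u f r) := fun r =>
    (stronglyMeasurable_dynkinCompensated hlam hf r).mono ((CadlagPath.filtration S).le r)
  have hmap : ∀ r, ∫ ω in A, dynkinCompensated lam u f r ω ∂(chainPathLaw lam u M i) =
      ∫ ω in chainPath i ⁻¹' A, dynkinCompensated lam u f r (chainPath i ω) ∂(chainLaw lam u M i) :=
    fun r => setIntegral_map hAm (hZm r).aestronglyMeasurable measurable_chainPath.aemeasurable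
  have hZi : ∀ r, IntegrableOn (fun ω => dynkinCompensated lam u f r (chainPath i ω))
      (chainPath i ⁻¹' A) (chainLaw lam u M i) := fun r =>
    (Integrable.of_bound ((hZm r).comp_measurable measurable_chainPath).aestronglyMeasurable _
      (ae_of_all _ fun ω => abs_dynkinCompensated_le hlam hM hf r _)).integrableOn
  have hC : 0 ≤ C := (abs_nonneg _).trans (hf i)
  rw [hmap, hmap]
  symm
  rw [← sub_eq_zero, ← integral_sub (hZi t) (hZi s)]
  have hJm : ∀ n, Measurable fun ω : ℕ → ℝ × S => jumpIncrement lam u f s t (ω n) (ω (n + 1)) :=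
    fun n => (measurable_jumpIncrement (u := u) hlam hf s t).comp
      (f := fun ω : ℕ → ℝ × S => (ω n, ω (n + 1))) (by fun_prop)
  have hzero : ∀ m : ℕ, ∫ ω in chainPath i ⁻¹' A, ∑ n ∈ Finset.range m,
      jumpIncrement lam u f s t (ω n) (ω (n + 1)) ∂(chainLaw lam u M i) = 0 := fun m => by
    rw [integral_finsetSum _ fun n _ => (Integrable.of_bound (hJm n).aestronglyMeasurable _
      (ae_of_all _ fun ω => abs_jumpIncrement_le hlam hM0 hM hf hst _ _)).integrableOn]
    exact Finset.sum_eq_zero fun n _ => setIntegral_jumpIncrement_eq_zero hlam hM0 hM hf hst hA n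
  have hsum : ∀ ω, IsRegularChain i ω → ∀ m, ∑ n ∈ Finset.range m,
      jumpIncrement lam u f s t (ω n) (ω (n + 1)) =
      dynkinCompensated lam u f (max s (min t (ω m).1.toNNReal)) (chainPath i ω) -
      dynkinCompensated lam u f s (chainPath i ω) := fun ω hω m => by
    rw [Finset.sum_congr rfl fun n _ => hω.jumpIncrement_eq hlam hf hst n,
      Finset.sum_range_sub (fun n =>
        dynkinCompensated lam u f (max s (min t (ω n).1.toNNReal)) (chainPath i ω))]
    simp [hω.1]
  have hlim : Tendsto (fun m : ℕ => ∫ ω in chainPath i ⁻¹' A, ∑ n ∈ Finset.range m,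
      jumpIncrement lam u f s t (ω n) (ω (n + 1)) ∂(chainLaw lam u M i)) atTop
      (𝓝 (∫ ω in chainPath i ⁻¹' A, (dynkinCompensated lam u f t (chainPath i ω) -
        dynkinCompensated lam u f s (chainPath i ω)) ∂(chainLaw lam u M i))) := by
    have hreg := ae_restrict_of_ae (s := chainPath i ⁻¹' A)
      (ae_isRegularChain (u := u) (i := i) hlam hM0 hM)
    refine tendsto_integral_of_dominated_convergence
      (fun _ => (C + 2 * M * C * t) + (C + 2 * M * C * t))
      (fun m => (Finset.measurable_fun_sum _ fun n _ => hJm n).aestronglyMeasurable)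
      (integrable_const _) (fun m => ?_) ?_
    · filter_upwards [hreg] with ω hω
      have hb : ∀ r : ℝ≥0, r ≤ t →
          |dynkinCompensated lam u f r (chainPath i ω)| ≤ C + 2 * M * C * t := fun r hr =>
        (abs_dynkinCompensated_le hlam hM hf r _).trans (by gcongr)
      rw [hsum ω hω m]
      exact (abs_sub _ _).trans (add_le_add (hb _ (max_le hst (min_le_left _ _))) (hb _ hst))
    · filter_upwards [hreg] with ω hω
      refine tendsto_const_nhds.congr' ?_
      filter_upwards [hω.2.2.eventually_ge_atTop (t : ℝ)] with m hm
      rw [hsum ω hω m, min_eq_left ((Real.le_toNNReal_iff_coe_le (t.2.trans hm)).2 hm),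
        max_eq_right hst]
  simp only [hzero] at hlim
  exact (tendsto_nhds_unique hlim tendsto_const_nhds)

theorem solvesMartingaleProblem_chainPathLaw (hlam : IsRateFamily lam) (hM0 : 0 < M)
    (hM : ∀ i v, -lam i i v ≤ M) :
    SolvesMartingaleProblem lam u (Measure.dirac i) (chainPathLaw lam u M i) where
  isProbabilityMeasure := inferInstance
  initial := by
    rw [chainPathLaw, Measure.map_map (CadlagPath.measurable_X 0) measurable_chainPath]
    have : (CadlagPath.X 0 ∘ chainPath i) =ᵐ[chainLaw lam u M i] fun _ => i := by
      filter_upwards [ae_isRegularChain hlam hM0 hM] with ω hω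
      have h1 : (ω 0).2 = i := by rw [hω.1]
      refine (hω.chainPath_X (k := 0) (by simp [hω.1]) ?_).trans h1
      have := hω.2.1 (Nat.lt_succ_self 0)
      simpa [hω.1] using this
    rw [Measure.map_congr this, Measure.map_const, measure_univ, one_smul]
  martingale f hf := by
    obtain ⟨C, hf⟩ := hf
    have hadapt := fun t => stronglyMeasurable_dynkinCompensated (u := u) hlam hf t
    have hint : ∀ t, Integrable (dynkinCompensated lam u f t) (chainPathLaw lam u M i) := fun t =>
      Integrable.of_bound ((hadapt t).mono ((CadlagPath.filtration S).le t)).aestronglyMeasurable _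
        (ae_of_all _ fun ω => abs_dynkinCompensated_le hlam hM hf t _)
    refine ⟨hadapt, fun s t hst => ?_⟩
    exact (ae_eq_condExp_of_forall_setIntegral_eq ((CadlagPath.filtration S).le s) (hint t)
      (fun A _ _ => (hint s).integrableOn)
      (fun A hA _ => setIntegral_dynkinCompensated hlam hM0 hM hf hst hA)
      (hadapt s).aestronglyMeasurable).symm

end Existence

/-- The martingale problem for bounded rates is solvable from every initial state. -/
theorem exists_solvesMartingaleProblem {S : Type*} [Countable S] [TopologicalSpace S]
    [DiscreteTopology S] [MeasurableSpace S] [DiscreteMeasurableSpace S]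
    {U : S → Type*} [∀ i, TopologicalSpace (U i)] [∀ i, MeasurableSpace (U i)]
    [∀ i, BorelSpace (U i)] {lam : (i : S) → S → U i → ℝ} (hlam : IsRateFamily lam)
    (u : MarkovControl U) (i : S) :
    ∃ P, SolvesMartingaleProblem lam u (Measure.dirac i) P := by
  obtain ⟨M, hM0, hM⟩ := hlam.exists_bound
  have := isMarkovKernel_jumpKernel (u := u) hlam hM0 hM
  exact ⟨_, solvesMartingaleProblem_chainPathLaw (M := M) hlam hM0 hM⟩

/-! ### Measurable selection of minimisers -/

section Selection

variable {Θ : Type*} [MeasurableSpace Θ]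

/-- For a Carathéodory function, the parameters at which some global minimiser lies in a given
compact set form a measurable set: it suffices to compare the values on countable dense sets. -/
lemma measurableSet_exists_minimiser_mem {K : Type*} [MetricSpace K] [CompactSpace K]
    {F : Θ → K → ℝ} (hm : ∀ k, Measurable fun x => F x k) (hc : ∀ x, Continuous (F x))
    {C : Set K} (hC : IsCompact C) : MeasurableSet {x | ∃ c ∈ C, ∀ k, F x c ≤ F x k} := by
  rcases C.eq_empty_or_nonempty with rfl | hne
  · simp
  have : Nonempty C := hne.to_subtype
  have : Nonempty K := ⟨hne.some⟩
  let d : ℕ → C := TopologicalSpace.denseSeq C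
  let e : ℕ → K := TopologicalSpace.denseSeq K
  have hd : DenseRange d := TopologicalSpace.denseRange_denseSeq C
  have he : DenseRange e := TopologicalSpace.denseRange_denseSeq K
  have heq : {x | ∃ c ∈ C, ∀ k, F x c ≤ F x k} =
      ⋂ p : ℕ × ℕ, ⋃ m : ℕ, {x | F x (d m) < F x (e p.1) + 1 / ((p.2 : ℝ) + 1)} := by
    ext x
    simp only [mem_iInter, mem_iUnion, mem_ofPred_eq]
    constructor
    · rintro ⟨c, hcC, hmin⟩ ⟨k, n⟩
      have hopen : IsOpen {c : C | F x c < F x (e k) + 1 / ((n : ℝ) + 1)} :=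
        isOpen_lt ((hc x).comp continuous_subtype_val) continuous_const
      obtain ⟨m, hm⟩ := hd.exists_mem_open hopen ⟨⟨c, hcC⟩, by
        have : 0 < 1 / ((n : ℝ) + 1) := by positivity
        have := hmin (e k)
        simp only [mem_ofPred_eq]
        linarith⟩
      exact ⟨m, hm⟩
    · intro h
      obtain ⟨c, hcC, hmin⟩ := hC.exists_isMinOn hne (hc x).continuousOn
      refine ⟨c, hcC, fun k => ?_⟩
      refine he.induction_on (p := fun k => F x c ≤ F x k) k
        (isClosed_le continuous_const (hc x)) fun j => ?_
      have hlim : Tendsto (fun n : ℕ => F x (e j) + 1 / ((n : ℝ) + 1)) atTop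
          (𝓝 (F x (e j) + 0)) :=
        tendsto_const_nhds.add tendsto_one_div_add_atTop_nhds_zero_nat
      rw [add_zero] at hlim
      refine ge_of_tendsto' hlim fun n => ?_
      obtain ⟨m, hm⟩ := h (j, n)
      exact (hmin (d m).2).trans hm.le
  rw [heq]
  exact MeasurableSet.iInter fun p => MeasurableSet.iUnion fun m =>
    measurableSet_lt (hm _) ((hm _).add_const _)

open Classical in
/-- The first `n` bits of the lexicographically smallest minimiser of `F x` on the Cantor space. -/
noncomputable def leastMinimiserPrefix (F : Θ → (ℕ → Bool) → ℝ) :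
    (n : ℕ) → Θ → (Fin n → Bool)
  | 0, _ => Fin.elim0
  | n + 1, x => Fin.snoc (leastMinimiserPrefix F n x) (if ∃ c ∈ {c : ℕ → Bool |
      (∀ k : Fin n, c k = leastMinimiserPrefix F n x k) ∧ c n = false}, ∀ b, F x c ≤ F x b
      then false else true)

lemma measurable_leastMinimiserPrefix {F : Θ → (ℕ → Bool) → ℝ}
    (hm : ∀ b, Measurable fun x => F x b) (hc : ∀ x, Continuous (F x)) (n : ℕ) :
    Measurable (leastMinimiserPrefix F n) := by
  induction n with
  | zero => exact measurable_const
  | succ n ih =>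
    let : MetricSpace (ℕ → Bool) := PiNat.metricSpaceOfDiscreteUniformity fun _ => rfl
    have hset : ∀ σ : Fin n → Bool, MeasurableSet {x | ∃ c ∈ {c : ℕ → Bool |
        (∀ k : Fin n, c k = σ k) ∧ c n = false}, ∀ b, F x c ≤ F x b} := fun σ => by
      refine measurableSet_exists_minimiser_mem hm hc (IsClosed.isCompact ?_)
      have h1 : IsClosed {c : ℕ → Bool | ∀ k : Fin n, c k = σ k} := by
        rw [ofPred_forall]
        exact isClosed_iInter fun k => isClosed_eq (continuous_apply _) continuous_const
      exact h1.inter (isClosed_eq (continuous_apply n) continuous_const)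
    have hset' : MeasurableSet {x | ∃ c ∈ {c : ℕ → Bool |
        (∀ k : Fin n, c k = leastMinimiserPrefix F n x k) ∧ c n = false}, ∀ b, F x c ≤ F x b} := by
      have : {x | ∃ c ∈ {c : ℕ → Bool |
          (∀ k : Fin n, c k = leastMinimiserPrefix F n x k) ∧ c n = false}, ∀ b, F x c ≤ F x b} =
          ⋃ σ : Fin n → Bool, leastMinimiserPrefix F n ⁻¹' {σ} ∩ {x | ∃ c ∈ {c : ℕ → Bool |
            (∀ k : Fin n, c k = σ k) ∧ c n = false}, ∀ b, F x c ≤ F x b} := by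
        ext x
        simp
      rw [this]
      exact MeasurableSet.iUnion fun σ => (ih (.singleton σ)).inter (hset σ)
    refine measurable_pi_iff.2 fun k => ?_
    refine Fin.lastCases ?_ (fun k => ?_) k
    · simp only [leastMinimiserPrefix, Fin.snoc_last]
      exact Measurable.ite hset' measurable_const measurable_const
    · simp only [leastMinimiserPrefix, Fin.snoc_castSucc]
      exact (measurable_pi_apply k).comp ih

/-- A Carathéodory function on the Cantor space has a measurable minimiser, namely the
lexicographically smallest one. -/
lemma exists_measurable_minimiser_cantor {F : Θ → (ℕ → Bool) → ℝ}
    (hm : ∀ b, Measurable fun x => F x b) (hc : ∀ x, Continuous (F x)) :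
    ∃ g : Θ → ℕ → Bool, Measurable g ∧ ∀ x b, F x (g x) ≤ F x b := by
  classical
  let g : Θ → ℕ → Bool := fun x n => leastMinimiserPrefix F (n + 1) x (Fin.last n)
  have hprefix : ∀ x n (k : Fin n), leastMinimiserPrefix F n x k = g x k := fun x n => by
    induction n with
    | zero => exact fun k => k.elim0
    | succ n ih =>
      intro k
      refine Fin.lastCases rfl (fun k => ?_) k
      rw [leastMinimiserPrefix, Fin.snoc_castSucc]
      exact ih k
  refine ⟨g, measurable_pi_iff.2 fun n =>
    (measurable_pi_apply _).comp (measurable_leastMinimiserPrefix hm hc (n + 1)), fun x b => ?_⟩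
  have hex : ∀ n, ∃ c : ℕ → Bool, (∀ k < n, c k = g x k) ∧ ∀ b, F x c ≤ F x b := fun n => by
    induction n with
    | zero =>
      obtain ⟨c, -, hcm⟩ := isCompact_univ.exists_isMinOn univ_nonempty (hc x).continuousOn
      exact ⟨c, by simp, fun b => hcm (mem_univ b)⟩
    | succ n ih =>
      obtain ⟨c, hcp, hcm⟩ := ih
      by_cases h : ∃ c ∈ {c : ℕ → Bool |
          (∀ k : Fin n, c k = leastMinimiserPrefix F n x k) ∧ c n = false}, ∀ b, F x c ≤ F x b
      · have hg : g x n = false := by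
          simp only [g, leastMinimiserPrefix, Fin.snoc_last, if_pos h]
        obtain ⟨c', ⟨h1, h2⟩, h3⟩ := h
        refine ⟨c', fun k hk => ?_, h3⟩
        rcases Nat.lt_succ_iff_lt_or_eq.1 hk with hk | rfl
        · exact (h1 ⟨k, hk⟩).trans (hprefix x n ⟨k, hk⟩)
        · rw [h2, hg]
      · have hg : g x n = true := by
          simp only [g, leastMinimiserPrefix, Fin.snoc_last, if_neg h]
        refine ⟨c, fun k hk => ?_, hcm⟩
        rcases Nat.lt_succ_iff_lt_or_eq.1 hk with hk | rfl
        · exact hcp k hk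
        · rw [hg]
          by_contra hck
          exact h ⟨c, ⟨fun j => (hcp j j.2).trans (hprefix x k j).symm, by simpa using hck⟩, hcm⟩
  -- minimisers agreeing with `g x` on longer and longer prefixes converge to `g x`
  choose c hcp hcm using hex
  have hlim : Tendsto c atTop (𝓝 (g x)) := by
    rw [tendsto_pi_nhds]
    intro k
    refine tendsto_const_nhds.congr' ?_
    filter_upwards [eventually_gt_atTop k] with n hn
    exact (hcp n k hn).symm
  exact le_of_tendsto' (((hc x).tendsto _).comp hlim) fun n => hcm n b

/-- A Carathéodory function on a nonempty compact metric space has a measurable minimiser: pull it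
back along a continuous surjection from the Cantor space. -/
theorem exists_measurable_minimiser {K : Type*} [MetricSpace K] [CompactSpace K] [Nonempty K]
    [MeasurableSpace K] [BorelSpace K] {F : Θ → K → ℝ} (hm : ∀ k, Measurable fun x => F x k)
    (hc : ∀ x, Continuous (F x)) : ∃ g : Θ → K, Measurable g ∧ ∀ x k, F x (g x) ≤ F x k := by
  obtain ⟨φ, hφ, hsurj⟩ := exists_nat_bool_continuous_surjective_of_compact K
  obtain ⟨g, hg, hmin⟩ := exists_measurable_minimiser_cantor (F := fun x b => F x (φ b))
    (fun b => hm _) (fun x => (hc x).comp hφ)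
  refine ⟨φ ∘ g, hφ.measurable.comp hg, fun x k => ?_⟩
  obtain ⟨b, rfl⟩ := hsurj k
  exact hmin x b

end Selection

/-! ### Verification -/

section ValueFunctions

variable {S : Type*} [Countable S] [TopologicalSpace S] [DiscreteTopology S]
    [MeasurableSpace S] [DiscreteMeasurableSpace S]
    {U : S → Type*} [∀ i, MetricSpace (U i)] [∀ i, CompactSpace (U i)] [∀ i, Nonempty (U i)]
    [∀ i, MeasurableSpace (U i)] [∀ i, BorelSpace (U i)] {lam : (i : S) → S → U i → ℝ}
    {c : (i : S) → U i → ℝ} {α θ : ℝ} {w : ℝ → S → ℝ}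

lemma continuous_hjbExpr (hlam : IsRateFamily lam) (hc : IsRunningCost c) {φ : S → ℝ} {C : ℝ}
    (hφ : ∀ j, |φ j| ≤ C) (θ : ℝ) (i : S) : Continuous (hjbExpr lam c θ φ i) :=
  ((continuous_const.mul (hc.continuous i)).mul continuous_const).add
    (hlam.continuous_tsum hφ i)

lemma iInf_hjbExpr_le (hlam : IsRateFamily lam) (hc : IsRunningCost c) {φ : S → ℝ} {C : ℝ}
    (hφ : ∀ j, |φ j| ≤ C) (θ : ℝ) (i : S) (v : U i) :
    ⨅ v, hjbExpr lam c θ φ i v ≤ hjbExpr lam c θ φ i v :=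
  ciInf_le (isCompact_range (continuous_hjbExpr hlam hc hφ θ i)).bddBelow v

theorem exists_isMinimisingSelector (hlam : IsRateFamily lam) (hc : IsRunningCost c) {C : ℝ}
    (hw_bdd : ∀ θ ∈ Ioo (0 : ℝ) 1, ∀ i, |w θ i| ≤ C)
    (hw_cont : ∀ i, ContinuousOn (fun θ => w θ i) (Ioo 0 1)) :
    ∃ ustar : ℝ → (i : S) → U i, IsMinimisingSelector lam c w ustar := by
  classical
  -- outside `(0, 1)`, where `w` is unconstrained, it is replaced by zero
  let w' : ℝ → S → ℝ := fun θ j => (Ioo (0 : ℝ) 1).piecewise (fun θ => w θ j) (fun _ => 0) θ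
  have hw' : ∀ θ ∈ Ioo (0 : ℝ) 1, w' θ = w θ := fun θ hθ => by
    funext j
    exact piecewise_eq_of_mem _ _ _ hθ
  have hw'm : ∀ j, Measurable fun θ => w' θ j := fun j =>
    ContinuousOn.measurable_piecewise (hw_cont j) continuousOn_const measurableSet_Ioo
  have hw'b : ∀ θ j, |w' θ j| ≤ max C 0 := fun θ j => by
    by_cases hθ : θ ∈ Ioo (0 : ℝ) 1
    · rw [hw' θ hθ]
      exact (hw_bdd θ hθ j).trans (le_max_left _ _)
    · simp only [w', piecewise_eq_of_notMem _ _ _ hθ, abs_zero]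
      exact le_max_right _ _
  have hsel : ∀ i, ∃ g : ℝ → U i, Measurable g ∧
      ∀ θ v, hjbExpr lam c θ (w' θ) i (g θ) ≤ hjbExpr lam c θ (w' θ) i v := fun i =>
    exists_measurable_minimiser (F := fun θ v => hjbExpr lam c θ (w' θ) i v)
      (fun v => ((measurable_id.mul_const _).mul (hw'm i)).add
        (measurable_tsum_of_summable (fun j => (hw'm j).const_mul _)
          fun θ => hlam.summable_mul (hw'b θ) i v))
      (fun θ => continuous_hjbExpr hlam hc (hw'b θ) θ i)
  choose g hgm hg using hsel
  refine ⟨fun θ i => g i θ, hgm, fun θ hθ i => ?_⟩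
  have h1 := hg i θ
  rw [hw' θ hθ] at h1
  exact le_antisymm (iInf_hjbExpr_le hlam hc (hw_bdd θ hθ) θ i _) (le_ciInf h1)

lemma solvesMartingaleProblem_controlledLaw (hlam : IsRateFamily lam) (u : MarkovControl U)
    (i : S) : SolvesMartingaleProblem lam u (Measure.dirac i) (controlledLaw lam u i) := by
  have h := exists_solvesMartingaleProblem hlam u i
  rw [controlledLaw, dif_pos h]
  exact h.choose_spec

lemma integrable_exp_discountedCost (hc : IsRunningCost c) (hα : 0 < α) (u : MarkovControl U)
    (P : Measure (CadlagPath S)) [IsProbabilityMeasure P] (θ : ℝ) :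
    Integrable (fun ω => Real.exp (θ * discountedCost c α u ω)) P := by
  obtain ⟨C, hC⟩ := hc.bounded
  have hm : StronglyMeasurable fun ω : CadlagPath S => discountedCost c α u ω :=
    stronglyMeasurable_pathIntegral CadlagPath.measurable_X CadlagPath.continuousWithinAt_X
      (b := fun t j => Real.exp (-α * t) * c j (u.toFun t.toNNReal j))
      (fun j => Measurable.mul (by fun_prop) ((hc.continuous j).measurable.comp
        ((u.measurable j).comp measurable_real_toNNReal))) (volume.restrict (Ioi 0))
  have hb : ∀ ω, |discountedCost c α u ω| ≤
      ∫ t in Ioi (0 : ℝ), Real.exp (-α * t) * C := fun ω => by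
    rw [discountedCost, ← Real.norm_eq_abs]
    refine norm_integral_le_of_norm_le ((exp_neg_integrableOn_Ioi 0 hα).mul_const C)
      (ae_of_all _ fun t => ?_)
    rw [norm_mul, Real.norm_eq_abs, Real.norm_eq_abs, Real.abs_exp,
      abs_of_nonneg (hc.nonneg _ _)]
    gcongr
    exact hC _ _
  refine Integrable.of_bound (Real.continuous_exp.comp_stronglyMeasurable
    (hm.const_mul θ)).aestronglyMeasurable
    (Real.exp (|θ| * ∫ t in Ioi (0 : ℝ), Real.exp (-α * t) * C)) (ae_of_all _ fun ω => ?_)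
  rw [Real.norm_eq_abs, Real.abs_exp]
  refine Real.exp_le_exp.2 ((le_abs_self _).trans ?_)
  rw [abs_mul]
  gcongr
  exact hb ω

/-- The verification inequality. With `ε = 1` it bounds the cost of an arbitrary control from below;
with `ε = -1`, applicable to controls attaining the infimum in the HJB equation, from above. -/
lemma verification (hlam : IsRateFamily lam) (hc : IsRunningCost c) (hα : 0 < α)
    {C : ℝ} (hw_bdd : ∀ θ ∈ Ioo (0 : ℝ) 1, ∀ i, |w θ i| ≤ C)
    (hw_smooth : ∀ i, ContDiffOn ℝ 1 (fun θ => w θ i) (Ioo 0 1))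
    (hw_hjb : ∀ θ ∈ Ioo (0 : ℝ) 1, ∀ i,
      α * θ * deriv (fun x => w x i) θ = ⨅ u : U i, hjbExpr lam c θ (w θ) i u)
    (hw_lim : TendstoUniformly w (fun _ => 1) (𝓝[>] (0 : ℝ)))
    {ε : ℝ} (hε : |ε| = 1) (u : MarkovControl U) (hθ : θ ∈ Ioo (0 : ℝ) 1)
    (hdrift : ∀ r : ℝ≥0, ∀ j, 0 ≤ ε * (hjbExpr lam c (θ * Real.exp (-α * r))
      (w (θ * Real.exp (-α * r))) j (u.toFun r j) -
        ⨅ v : U j, hjbExpr lam c (θ * Real.exp (-α * r)) (w (θ * Real.exp (-α * r))) j v))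
    (i : S) :
    ε * w θ i ≤ ε * ∫ ω, Real.exp (θ * discountedCost c α u ω) ∂(controlledLaw lam u i) := by
  obtain ⟨M, hM0, hM⟩ := hlam.exists_bound
  obtain ⟨Cc, hCc⟩ := hc.bounded
  obtain ⟨ustar, hustar⟩ := exists_isMinimisingSelector (lam := lam) hlam hc hw_bdd
    fun i => (hw_smooth i).continuousOn
  have hCc0 : 0 ≤ Cc := (hc.nonneg i (ustar 0 i)).trans (hCc _ _)
  set ϑ : ℝ → ℝ := fun r => θ * Real.exp (-α * r) with hϑ
  have hϑle : ∀ r, 0 ≤ r → ϑ r ≤ Real.exp (-α * r) := fun r _ =>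
    mul_le_of_le_one_left (Real.exp_pos _).le hθ.2.le
  have hexp1 : ∀ r, 0 ≤ r → Real.exp (-α * r) ≤ 1 := fun r hr =>
    Real.exp_le_one_iff.2 (by nlinarith)
  have hϑmem : ∀ r, 0 ≤ r → ϑ r ∈ Ioo (0 : ℝ) 1 := fun r hr =>
    ⟨mul_pos hθ.1 (Real.exp_pos _),
      (mul_le_of_le_one_right hθ.1.le (hexp1 r hr)).trans_lt hθ.2⟩
  have hϑd : ∀ r, HasDerivAt ϑ (-α * ϑ r) r := fun r => by
    have := (((hasDerivAt_id r).const_mul (-α)).exp).const_mul θ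
    convert! this using 1
    simp [hϑ]
    ring
  have hϑc : Continuous ϑ := by fun_prop
  let w' : ℝ → S → ℝ := fun x j => deriv (fun x => w x j) x
  have hw'b : ∀ x ∈ Ioo (0 : ℝ) 1, ∀ j, |α * x * w' x j| ≤ Cc * C + 2 * M * C := by
    intro x hx j
    rw [hw_hjb x hx j, hustar.attains x hx j, hjbExpr]
    refine (abs_add_le _ _).trans (add_le_add ?_ (hlam.abs_tsum_le hM (hw_bdd x hx) j _))
    rw [abs_mul, abs_mul, abs_of_pos hx.1, abs_of_nonneg (hc.nonneg _ _)]
    have h1 : x * c j (ustar x j) ≤ Cc :=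
      (mul_le_of_le_one_left (hc.nonneg _ _) hx.2.le).trans (hCc _ _)
    exact mul_le_mul h1 (hw_bdd x hx j) (abs_nonneg _) hCc0
  have hsub : IsSubsolution lam u (fun r j => ϑ r * c j (u.toFun r.toNNReal j))
      (fun r j => ε * w (ϑ r) j) (fun r j => ε * (-(α * ϑ r * w' (ϑ r) j))) Cc C
      (Cc * C + 2 * M * C) :=
    { measurable_rate := fun j => hϑc.measurable.mul ((hc.continuous j).measurable.comp
        ((u.measurable j).comp measurable_real_toNNReal))
      rate_nonneg := fun r hr j => mul_nonneg (hϑmem r hr).1.le (hc.nonneg _ _)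
      rate_le := fun r hr j =>
        (mul_le_of_le_one_left (hc.nonneg _ _) (hϑmem r hr).2.le).trans (hCc _ _)
      bound := fun r hr j => by
        rw [abs_mul, hε, one_mul]
        exact hw_bdd _ (hϑmem r hr) j
      measurable_deriv := fun j =>
        (((hϑc.measurable.const_mul α).mul
          ((measurable_deriv _).comp hϑc.measurable)).neg).const_mul ε
      deriv_bound := fun r hr j => by
        rw [abs_mul, hε, one_mul, abs_neg]
        exact hw'b _ (hϑmem r hr) j
      integral_deriv := fun s t hs hst j => by
        have hnn : ∀ r ∈ uIcc s t, 0 ≤ r := fun r hr => by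
          rw [uIcc_of_le hst] at hr
          exact hs.trans hr.1
        have hcont : ContinuousOn (fun r => w' (ϑ r) j) (uIcc s t) :=
          ((hw_smooth j).continuousOn_deriv_of_isOpen isOpen_Ioo le_rfl).comp hϑc.continuousOn
            fun r hr => hϑmem r (hnn r hr)
        have hI : ContinuousOn (fun r => ε * (-(α * ϑ r * w' (ϑ r) j))) (uIcc s t) :=
          continuousOn_const.mul ((continuousOn_const.mul hϑc.continuousOn).mul hcont).neg
        refine (intervalIntegral.integral_eq_sub_of_hasDerivAt
          (f := fun r => ε * w (ϑ r) j) (fun r hr => ?_)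
          hI.intervalIntegrable).symm
        have hd : HasDerivAt (fun x => w x j) (w' (ϑ r) j) (ϑ r) :=
          (((hw_smooth j).differentiableOn one_ne_zero).differentiableAt
            (isOpen_Ioo.mem_nhds (hϑmem r (hnn r hr)))).hasDerivAt
        convert! (hd.comp r (hϑd r)).const_mul ε using 1
        ring
      drift_nonneg := fun r hr j => by
        have h := hdrift r.toNNReal j
        rw [Real.coe_toNNReal r hr, ← hw_hjb _ (hϑmem r hr) j, hjbExpr] at h
        have e : controlledGenerator lam u r.toNNReal (fun k => ε * w (ϑ r) k) j =
            ε * ∑' k, lam j k (u.toFun r.toNNReal j) * w (ϑ r) k := by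
          rw [controlledGenerator, ← tsum_mul_left]
          exact tsum_congr fun k => by ring
        rw [e]
        refine h.trans (le_of_eq ?_)
        simp only [w']
        ring }
  have hϑlim : Tendsto ϑ atTop (𝓝[>] 0) := by
    refine tendsto_nhdsWithin_iff.2 ⟨?_, Eventually.of_forall fun r =>
      mul_pos hθ.1 (Real.exp_pos _)⟩
    have h1 : Tendsto (fun r => -α * r) atTop atBot :=
      tendsto_id.const_mul_atTop_of_neg (neg_lt_zero.2 hα)
    have h2 := (Real.tendsto_exp_atBot.comp h1).const_mul θ
    rw [mul_zero] at h2
    exact h2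
  have hglim : TendstoUniformly (fun r j => ε * w (ϑ r) j) (fun _ => ε) atTop := by
    rw [Metric.tendstoUniformly_iff] at hw_lim ⊢
    intro δ hδ
    filter_upwards [hϑlim.eventually (hw_lim δ hδ)] with r hr j
    have := hr j
    rw [Real.dist_eq] at this ⊢
    rwa [show ε - ε * w (ϑ r) j = ε * (1 - w (ϑ r) j) by ring, abs_mul, hε, one_mul]
  have key := hsub.le_mul_integral_exp hlam (solvesMartingaleProblem_controlledLaw hlam u i) hα
    (fun r hr j => by
      rw [mul_comm Cc]
      exact mul_le_mul (hϑle r hr) (hCc _ _) (hc.nonneg _ _) (Real.exp_pos _).le) hglim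
  have e0 : ϑ 0 = θ := by simp [hϑ]
  have e1 : ∀ ω : CadlagPath S, ∫ r in Ioi (0 : ℝ), ϑ r * c (ω.X r.toNNReal)
      (u.toFun r.toNNReal (ω.X r.toNNReal)) = θ * discountedCost c α u ω := fun ω => by
    rw [discountedCost, ← integral_const_mul]
    refine integral_congr_ae (ae_of_all _ fun r => ?_)
    simp only [hϑ]
    ring
  simpa only [e0, e1] using key

end ValueFunctions

theorem theorem3p1 {S : Type*} [Countable S] [TopologicalSpace S] [DiscreteTopology S]
    [MeasurableSpace S] [DiscreteMeasurableSpace S]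
    {U : S → Type*} [∀ i, MetricSpace (U i)] [∀ i, CompactSpace (U i)] [∀ i, Nonempty (U i)]
    [∀ i, MeasurableSpace (U i)] [∀ i, BorelSpace (U i)]
    (lam : (i : S) → S → U i → ℝ) (hlam : IsRateFamily lam)
    (c : (i : S) → U i → ℝ) (hc : IsRunningCost c)
    (α : ℝ) (hα : 0 < α)
    (w : ℝ → S → ℝ)
    (hw_bdd : ∃ C : ℝ, ∀ θ ∈ Ioo (0 : ℝ) 1, ∀ i, |w θ i| ≤ C)
    (hw_smooth : ∀ i, ContDiffOn ℝ 1 (fun θ => w θ i) (Ioo 0 1))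
    (hw_hjb : ∀ θ ∈ Ioo (0 : ℝ) 1, ∀ i,
      α * θ * deriv (fun x => w x i) θ = ⨅ u : U i, hjbExpr lam c θ (w θ) i u)
    (hw_lim : TendstoUniformly w (fun _ => 1) (𝓝[>] (0 : ℝ))) :
    (∀ θ ∈ Ioo (0 : ℝ) 1, ∀ i, w θ i = expDiscountedValue lam c α θ i) ∧
    (∃ ustar : ℝ → (i : S) → U i, IsMinimisingSelector lam c w ustar) ∧
    (∀ (ustar : ℝ → (i : S) → U i) (hu : IsMinimisingSelector lam c w ustar),
      ∀ θ ∈ Ioo (0 : ℝ) 1, ∀ i,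
        Real.exp (θ * riskSensitiveCost lam c α θ i
            (feedbackControl α θ ustar hu.measurable)) = expDiscountedValue lam c α θ i ∧
        riskSensitiveCost lam c α θ i
            (feedbackControl α θ ustar hu.measurable) = discountedValue lam c α θ i) ∧
    (∀ θ ∈ Ioo (0 : ℝ) 1, ∀ i, 1 / θ * Real.log (w θ i) = discountedValue lam c α θ i) := by
  obtain ⟨C, hw_bdd⟩ := hw_bdd
  -- the expectation of the exponential cost
  let E : ℝ → S → MarkovControl U → ℝ := fun θ i u =>
    ∫ ω, Real.exp (θ * discountedCost c α u ω) ∂(controlledLaw lam u i)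
  have hEpos : ∀ θ i u, 0 < E θ i u := fun θ i u => by
    have := (solvesMartingaleProblem_controlledLaw hlam u i).isProbabilityMeasure
    exact integral_exp_pos (integrable_exp_discountedCost hc hα u _ θ)
  have hexp : ∀ θ ∈ Ioo (0 : ℝ) 1, ∀ i u,
      Real.exp (θ * riskSensitiveCost lam c α θ i u) = E θ i u := fun θ hθ i u => by
    rw [riskSensitiveCost, ← mul_assoc, mul_one_div_cancel hθ.1.ne', one_mul,
      Real.exp_log (hEpos θ i u)]
  have hmem : ∀ θ ∈ Ioo (0 : ℝ) 1, ∀ r : ℝ≥0, θ * Real.exp (-α * r) ∈ Ioo (0 : ℝ) 1 :=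
    fun θ hθ r => ⟨mul_pos hθ.1 (Real.exp_pos _),
      (mul_le_of_le_one_right hθ.1.le (Real.exp_le_one_iff.2
        (by nlinarith [r.coe_nonneg]))).trans_lt hθ.2⟩
  have hge : ∀ θ ∈ Ioo (0 : ℝ) 1, ∀ i u, w θ i ≤ E θ i u := fun θ hθ i u => by
    have := verification hlam hc hα hw_bdd hw_smooth hw_hjb hw_lim (ε := 1) abs_one u hθ
      (fun r j => by
        rw [one_mul, sub_nonneg]
        exact iInf_hjbExpr_le hlam hc (hw_bdd _ (hmem θ hθ r)) _ j _) i
    rwa [one_mul, one_mul] at this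
  have heq : ∀ (ustar : ℝ → (i : S) → U i) (hu : IsMinimisingSelector lam c w ustar),
      ∀ θ ∈ Ioo (0 : ℝ) 1, ∀ i, E θ i (feedbackControl α θ ustar hu.measurable) = w θ i := by
    intro ustar hu θ hθ i
    refine le_antisymm ?_ (hge θ hθ i _)
    have := verification hlam hc hα hw_bdd hw_smooth hw_hjb hw_lim (ε := -1) (by simp)
      (feedbackControl α θ ustar hu.measurable) hθ
      (fun r j => by
        rw [hu.attains _ (hmem θ hθ r) j]
        simp [feedbackControl]) i
    linarith
  obtain ⟨v, hv⟩ := exists_isMinimisingSelector (lam := lam) hlam hc hw_bdd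
    fun i => (hw_smooth i).continuousOn
  have hW : ∀ θ ∈ Ioo (0 : ℝ) 1, ∀ i, w θ i = expDiscountedValue lam c α θ i := by
    intro θ hθ i
    have hleast : IsLeast (range fun u : MarkovControl U =>
        Real.exp (θ * riskSensitiveCost lam c α θ i u)) (w θ i) := by
      refine ⟨⟨feedbackControl α θ v hv.measurable, ?_⟩, ?_⟩
      · dsimp only
        rw [hexp θ hθ, heq v hv θ hθ]
      · rintro _ ⟨u, rfl⟩
        dsimp only
        rw [hexp θ hθ]
        exact hge θ hθ i u
    exact hleast.csInf_eq.symm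
  have hV : ∀ θ ∈ Ioo (0 : ℝ) 1, ∀ i, 1 / θ * Real.log (w θ i) = discountedValue lam c α θ i := by
    intro θ hθ i
    have hwpos : 0 < w θ i := heq v hv θ hθ i ▸ hEpos _ _ _
    have hleast : IsLeast (range fun u : MarkovControl U => riskSensitiveCost lam c α θ i u)
        (1 / θ * Real.log (w θ i)) := by
      refine ⟨⟨feedbackControl α θ v hv.measurable, ?_⟩, ?_⟩
      · rw [← heq v hv θ hθ i]
        rfl
      · rintro _ ⟨u, rfl⟩
        exact mul_le_mul_of_nonneg_left (Real.log_le_log hwpos (hge θ hθ i u))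
          (one_div_nonneg.2 hθ.1.le)
    exact hleast.csInf_eq.symm
  refine ⟨hW, ⟨v, hv⟩, fun ustar hu θ hθ i => ⟨?_, ?_⟩, hV⟩
  · rw [hexp θ hθ, heq ustar hu θ hθ, hW θ hθ]
  · rw [← hV θ hθ, ← heq ustar hu θ hθ i]
    rfl
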